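/- Let $X$ be a fixed real $n\times d$ matrix without zero columns, put $\mathbb{X} := X^\top X$, and consider the linear regression model $\mathbf{Y} = X\beta_\star + \varepsilon$ with $\beta_\star\in\mathbb{R}^d$, $\mathbb{E}[\varepsilon]=0$ and $\mathrm{Cov}(\varepsilon)=I_n$. For a $d\times d$ matrix $A$ let $\mathrm{Diag}(A)$ be the diagonal matrix with the same main diagonal as $A$, and for $p\in(0,1)$ let $A_p := pA+(1-p)\mathrm{Diag}(A)$. Write $\|\cdot\|$ for the spectral norm and $\lambda_{\min}$ for the smallest eigenvalue of a symmetric matrix. A $p$-dropout matrix is a random diagonal $d\times d$ matrix whose diagonal entries are i.i.d. $\mathrm{Ber}(p)$ (equal to $1$ with probability $p$ and to $0$ otherwise). Let $\tilde\beta_0$ be a square integrable random vector in $\mathbb{R}^d$ that is independent of $\mathbf{Y}$, and let $D_1, D_2,\ldots$ be i.i.d. $p$-dropout matrices, independent of $(\mathbf{Y},\tilde\beta_0)$. For a learning rate $\alpha>0$, gradient descent with dropout is given by $$\tilde\beta_{k} = \tilde\beta_{k-1} + \alpha D_{k} X^\top\big(\mathbf{Y} - X D_{k}\tilde\beta_{k-1}\big),\qquad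 k=1,2,\ldots$$ Let $\tilde\beta := \operatorname{argmin}_{\beta\in\mathbb{R}^d}\mathbb{E}\big[\|\mathbf{Y}-XD\beta\|_2^2 \mid \mathbf{Y}\big]$, where $D$ is a $p$-dropout matrix independent of $\mathbf{Y}$. Then there are constants $C'$ and $C''$, depending only on $X$, $\beta_\star$ and the distributions of $\varepsilon$ and $\tilde\beta_0$, and in particular not on $(\alpha,p,k)$, such that for all $\alpha>0$ and $p\in(0,1)$ with $$\alpha p\|\mathbb{X}\|<1\qquad\text{and}\qquad \alpha<\frac{\lambda_{\min}(\mathbb{X}_p)}{3\|\mathbb{X}\|^2}$$ and all $k=1,2,\ldots$, $$\big\|\mathrm{Cov}(\tilde\beta_k)-\mathrm{Cov}(\tilde\beta)\big\| \le \frac{k\,\|I-\alpha p\mathbb{X}_p\|^{k-1}C'+\alpha p\,C''}{(1-p)^2}$$ and $$\big\|\mathrm{Cov}(\tilde\beta_k)-\mathrm{Diag}(\mathbb{X})^{-1}\mathbb{X}\,\mathrm{Diag}(\mathbb{X})^{-1}\big\| \le \frac{k\,\|I-\alpha p\mathbb{X}_p\|^{k-1}C'+p(1+\alpha)\,C''}{(1-p)^2}.$$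 -/

import Mathlib

open MeasureTheory ProbabilityTheory
open scoped Matrix Matrix.Norms.L2Operator

namespace Dropout

noncomputable section

/-- The Gram matrix `Xᵀ X` of the design matrix. -/
def gram {n d : ℕ} (X : Matrix (Fin n) (Fin d) ℝ) : Matrix (Fin d) (Fin d) ℝ :=
  Xᵀ * X

/-- `Diag(A)`: the diagonal matrix with the same main diagonal as `A`. -/
def diagPart {d : ℕ} (A : Matrix (Fin d) (Fin d) ℝ) : Matrix (Fin d) (Fin d) ℝ :=
  Matrix.diagonal A.diag

/-- `A_p = p A + (1 - p) Diag(A)`. -/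
def offDiagScale {d : ℕ} (p : ℝ) (A : Matrix (Fin d) (Fin d) ℝ) : Matrix (Fin d) (Fin d) ℝ :=
  p • A + (1 - p) • diagPart A

/-- The smallest eigenvalue of a symmetric matrix. -/
def lambdaMin {d : ℕ} (A : Matrix (Fin d) (Fin d) ℝ) : ℝ :=
  sInf (spectrum ℝ A)

/-- The covariance matrix of a random vector. -/
def covMatrix {Ω : Type*} [MeasurableSpace Ω] {m : ℕ} (Z : Ω → Fin m → ℝ) (μ : Measure Ω) :
    Matrix (Fin m) (Fin m) ℝ :=
  Matrix.of fun i j => covariance (fun ω => Z ω i) (fun ω => Z ω j) μ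

/-- The law of the diagonal of a `p`-dropout matrix: `d` independent `Ber(p)` entries.
A dropout matrix is `Matrix.diagonal δ` for a random vector `δ` with this law. -/
def dropoutLaw (d : ℕ) (p : unitInterval) : Measure (Fin d → ℝ) :=
  Measure.pi fun _ => bernoulliMeasure (1 : ℝ) 0 p

/-- The loss `E[‖Y - X D b‖₂² | Y = y]`, with the noise of the dropout matrix `D`
(which is independent of `Y`) integrated out. -/
def marginalizedLoss {n d : ℕ} (X : Matrix (Fin n) (Fin d) ℝ) (p : unitInterval)
    (y : Fin n → ℝ) (b : Fin d → ℝ) : ℝ :=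
  ∫ δ, ‖WithLp.toLp 2 (y - (X * Matrix.diagonal δ) *ᵥ b)‖ ^ 2 ∂(dropoutLaw d p)

/-- The estimator `y ↦ b y` minimizes the marginalized loss. -/
def IsMarginalizedLossMinimizer {n d : ℕ} (X : Matrix (Fin n) (Fin d) ℝ) (p : unitInterval)
    (b : (Fin n → ℝ) → (Fin d → ℝ)) : Prop :=
  ∀ y, IsMinOn (marginalizedLoss X p y) Set.univ (b y)

/-- Gradient descent with dropout: the `(k + 1)`-st step uses the dropout matrix
`D = Matrix.diagonal (δ k)` and maps `b` to
`b - α ∇_b (1/2) ‖y - X D b‖₂² = b + α D Xᵀ (y - X D b)`. -/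
def dropoutIterate {n d : ℕ} (X : Matrix (Fin n) (Fin d) ℝ) (α : ℝ)
    (y : Fin n → ℝ) (b₀ : Fin d → ℝ) (δ : ℕ → Fin d → ℝ) : ℕ → Fin d → ℝ
  | 0 => b₀
  | k + 1 =>
    let b := dropoutIterate X α y b₀ δ k
    let D := Matrix.diagonal (δ k)
    b + α • ((D * Xᵀ) *ᵥ (y - (X * D) *ᵥ b))

end

end Dropout

/-! Write `G` for the Gram matrix, `H` for its off-diagonal part, `G_p` for `offDiagScale p G`, `l`
for the smallest eigenvalue of `G_p`, and `q = ‖1 - αp G_p‖`. The minimizer `v` of the marginalized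
loss solves `G_p v = Xᵀ Y`. Since `D² = D`, the error `e_k`, iterate minus `v`, obeys `e_{k+1} = (1
- α D G D) e_k + α D H (p - D) v` (`step_sub_eq_errStep`). Here `E[D G D] = p G_p`, and `E[D H (p -
D)] = 0` because `H` has zero diagonal and distinct mask entries are independent. A fresh `D` is
independent of `(e_k, v)`, so `E[e_k φ(v)]` is multiplied by `1 - αp G_p` at each step and decays
like `q^k` (`abs_integral_chain_mul_le`).

For `a_k = E‖e_k‖²`, squaring the recursion gives `a_{k+1} ≤ r a_k + c q^k + (1 - r) B` with `r = 1
- αpl ≤ q` and `B` of order `αp` (`integral_chain_sq_le`). The middle term is the cross moment of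
`e_k` and `v`; it resonates with the contraction and produces `k q^(k-1)`. The last term is the
variance of the noise driven by `v`. Its factor `1 - p` is absorbed by `l ≥ (1 - p) m`, where `m`
bounds the diagonal of `G` below, so the only loss in `1 - p` is the bound on `E‖v‖²`, of order `(1
- p)⁻²`. Expanding `Cov(e_k + v)` then yields the first estimate.

For the second, `Diag(G)⁻¹ Xᵀ Y = v + p Diag(G)⁻¹ H v`: the left side has covariance `Diag(G)⁻¹ G
Diag(G)⁻¹`, and it differs from `v` by a term of order `p`. -/

namespace Dropout

/-! ### Moments of dropout masks -/

section Law

variable {d : ℕ} {p : unitInterval}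

instance isProbabilityMeasure_dropoutLaw : IsProbabilityMeasure (dropoutLaw d p) := by
  unfold dropoutLaw; infer_instance

lemma ae_dropoutLaw : ∀ᵐ δ ∂(dropoutLaw d p), ∀ i, δ i = 1 ∨ δ i = 0 := by
  refine ae_all_iff.2 fun i => ?_
  have h : ∀ᵐ x ∂(bernoulliMeasure (1 : ℝ) 0 p), x = 1 ∨ x = 0 := by
    have hs : MeasurableSet ({1, 0} : Set ℝ)ᶜ := (Set.toFinite _).measurableSet.compl
    rw [ae_iff]
    have : {a : ℝ | ¬ (a = 1 ∨ a = 0)} = ({1, 0} : Set ℝ)ᶜ := by ext; simp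
    rw [this]
    exact bernoulliMeasure_apply_of_notMem_of_notMem p hs (by simp) (by simp)
  exact (measurePreserving_eval (fun _ : Fin d => bernoulliMeasure (1 : ℝ) 0 p)
    i).quasiMeasurePreserving.ae h

/-- The law is carried by the compact cube `[0, 1]^d`. This discharges all integrability goals for
polynomials in the mask. -/
lemma integrable_dropoutLaw {f : (Fin d → ℝ) → ℝ} (hf : Continuous f) :
    Integrable f (dropoutLaw d p) := by
  have h : ∀ᵐ δ ∂(dropoutLaw d p), δ ∈ Set.Icc (0 : Fin d → ℝ) 1 := by
    filter_upwards [ae_dropoutLaw] with δ hδ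
    refine ⟨fun i => ?_, fun i => ?_⟩ <;> rcases hδ i with h | h <;> simp [h]
  have := hf.continuousOn.integrableOn_compact (μ := dropoutLaw d p)
    (isCompact_Icc (a := (0 : Fin d → ℝ)) (b := 1))
  rwa [IntegrableOn, Measure.restrict_eq_self_of_ae_mem h] at this

lemma integral_coord (i : Fin d) : ∫ δ, δ i ∂(dropoutLaw d p) = p := by
  have h := (measurePreserving_eval (fun _ : Fin d => bernoulliMeasure (1 : ℝ) 0 p) i)
  have := integral_map (μ := dropoutLaw d p) (φ := Function.eval i) (f := fun x : ℝ => x)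
    h.measurable.aemeasurable (by fun_prop)
  rw [dropoutLaw, h.map_eq, integral_bernoulliMeasure] at this
  simpa [dropoutLaw] using this.symm

lemma integral_coord_mul_coord {i j : Fin d} (hij : i ≠ j) :
    ∫ δ, δ i * δ j ∂(dropoutLaw d p) = (p : ℝ) * p := by
  have hi := iIndepFun_pi (μ := fun _ : Fin d => bernoulliMeasure (1 : ℝ) 0 p)
    (X := fun _ x => x) (fun _ => by fun_prop)
  have := (hi.indepFun hij).integral_fun_mul_eq_mul_integral
    (Measurable.aestronglyMeasurable (by fun_prop)) (Measurable.aestronglyMeasurable (by fun_prop))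
  rw [← dropoutLaw] at this
  rw [this, integral_coord, integral_coord]

lemma integral_coord_mul_coord_self (i : Fin d) :
    ∫ δ, δ i * δ i ∂(dropoutLaw d p) = p := by
  rw [← integral_coord i (p := p)]
  refine integral_congr_ae ?_
  filter_upwards [ae_dropoutLaw] with δ hδ
  rcases hδ i with h | h <;> simp [h]

lemma offDiagScale_apply (A : Matrix (Fin d) (Fin d) ℝ) (i j : Fin d) :
    offDiagScale p A i j = if i = j then A i j else p * A i j := by
  simp only [offDiagScale, diagPart, Matrix.add_apply, Matrix.smul_apply, smul_eq_mul,
    Matrix.diagonal_apply, Matrix.diag_apply]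
  split_ifs with h
  · subst h; ring
  · ring

lemma integral_mask_mulVec_mask (A : Matrix (Fin d) (Fin d) ℝ) (u : Fin d → ℝ) (i : Fin d) :
    ∫ δ, (δ * (A *ᵥ (δ * u))) i ∂(dropoutLaw d p) = p * (offDiagScale p A *ᵥ u) i := by
  simp only [Pi.mul_apply, Matrix.mulVec, dotProduct, Finset.mul_sum]
  rw [integral_finsetSum _ fun j _ => integrable_dropoutLaw (by fun_prop)]
  refine Finset.sum_congr rfl fun j _ => ?_
  have : ∀ δ : Fin d → ℝ, δ i * (A i j * (δ j * u j)) = A i j * u j * (δ i * δ j) :=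
    fun δ => by ring
  simp_rw [this, integral_const_mul, offDiagScale_apply]
  split_ifs with h
  · subst h; rw [integral_coord_mul_coord_self]; ring
  · rw [integral_coord_mul_coord h]; ring

/-- For `i ≠ j` independence gives `E[δ i (p - δ j)] = p² - p² = 0`, and the zero diagonal removes
the remaining terms. -/
lemma integral_mask_mulVec_centered {H : Matrix (Fin d) (Fin d) ℝ} (hH : ∀ i, H i i = 0)
    (v : Fin d → ℝ) (i : Fin d) :
    ∫ δ, (δ * (H *ᵥ ((fun j => (p : ℝ) - δ j) * v))) i ∂(dropoutLaw d p) = 0 := by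
  simp only [Pi.mul_apply, Matrix.mulVec, dotProduct, Finset.mul_sum]
  rw [integral_finsetSum _ fun j _ => integrable_dropoutLaw (by fun_prop)]
  refine Finset.sum_eq_zero fun j _ => ?_
  by_cases h : i = j
  · subst h; simp [hH]
  have : ∀ δ : Fin d → ℝ, δ i * (H i j * (((p : ℝ) - δ j) * v j))
      = H i j * v j * (p * δ i - δ i * δ j) := fun δ => by ring
  simp_rw [this]
  rw [integral_const_mul, integral_sub (integrable_dropoutLaw (by fun_prop))
    (integrable_dropoutLaw (by fun_prop)), integral_const_mul, integral_coord,
    integral_coord_mul_coord h, sub_self, mul_zero]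

lemma integral_dotProduct (u : Fin d → ℝ) {f : (Fin d → ℝ) → Fin d → ℝ}
    (hf : Continuous f) :
    ∫ δ, u ⬝ᵥ f δ ∂(dropoutLaw d p) = u ⬝ᵥ fun i => ∫ δ, f δ i ∂(dropoutLaw d p) := by
  simp only [dotProduct]
  rw [integral_finsetSum _ fun j _ => integrable_dropoutLaw (by fun_prop)]
  exact Finset.sum_congr rfl fun j _ => integral_const_mul _ _

lemma integral_sum_sq_mask (u : Fin d → ℝ) :
    ∫ δ, (δ * u) ⬝ᵥ (δ * u) ∂(dropoutLaw d p) = p * (u ⬝ᵥ u) := by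
  simp only [Pi.mul_apply, dotProduct, Finset.mul_sum]
  rw [integral_finsetSum _ fun j _ => integrable_dropoutLaw (by fun_prop)]
  refine Finset.sum_congr rfl fun j _ => ?_
  have : ∀ δ : Fin d → ℝ, δ j * u j * (δ j * u j) = u j * u j * (δ j * δ j) :=
    fun δ => by ring
  simp_rw [this, integral_const_mul, integral_coord_mul_coord_self]
  ring

lemma integral_mask_quadratic (A : Matrix (Fin d) (Fin d) ℝ) (u w : Fin d → ℝ) :
    ∫ δ, (δ * u) ⬝ᵥ (A *ᵥ (δ * w)) ∂(dropoutLaw d p) = p * (u ⬝ᵥ (offDiagScale p A *ᵥ w)) := by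
  have : ∀ δ : Fin d → ℝ, (δ * u) ⬝ᵥ (A *ᵥ (δ * w)) = u ⬝ᵥ (δ * (A *ᵥ (δ * w))) := by
    intro δ
    simp only [dotProduct, Pi.mul_apply]
    exact Finset.sum_congr rfl fun i _ => by ring
  simp_rw [this]
  rw [integral_dotProduct _ (by fun_prop)]
  simp_rw [integral_mask_mulVec_mask]
  simp only [dotProduct, Finset.mul_sum]
  exact Finset.sum_congr rfl fun i _ => by ring

end Law

/-! ### Spectral norm versus matrix entries -/

section Norm

variable {m n d : ℕ}

lemma dotProduct_self_eq_norm_sq (u : Fin d → ℝ) : u ⬝ᵥ u = ‖WithLp.toLp 2 u‖ ^ 2 := by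
  rw [EuclideanSpace.real_norm_sq_eq]
  simp [dotProduct, sq]

lemma mulVec_dotProduct_self_le (A : Matrix (Fin m) (Fin n) ℝ) (u : Fin n → ℝ) :
    (A *ᵥ u) ⬝ᵥ (A *ᵥ u) ≤ ‖A‖ ^ 2 * (u ⬝ᵥ u) := by
  rw [dotProduct_self_eq_norm_sq, dotProduct_self_eq_norm_sq, ← mul_pow]
  gcongr
  simpa using A.l2_opNorm_mulVec (WithLp.toLp 2 u)

lemma dotProduct_self_nonneg_real (u : Fin d → ℝ) : 0 ≤ u ⬝ᵥ u := by
  exact Finset.sum_nonneg fun i _ => mul_self_nonneg _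

lemma sq_le_dotProduct_self (u : Fin d → ℝ) (i : Fin d) : u i ^ 2 ≤ u ⬝ᵥ u := by
  rw [sq]
  exact Finset.single_le_sum (f := fun i => u i * u i) (fun j _ => mul_self_nonneg _)
    (Finset.mem_univ i)

lemma abs_apply_le_norm (A : Matrix (Fin m) (Fin n) ℝ) (i : Fin m) (j : Fin n) :
    |A i j| ≤ ‖A‖ := by
  have h := mulVec_dotProduct_self_le A (Pi.single j 1)
  have h2 := sq_le_dotProduct_self (A *ᵥ Pi.single j 1) i
  simp only [Matrix.mulVec_single_one, Matrix.col_apply, single_dotProduct, Pi.single_eq_same,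
    mul_one] at h h2
  exact abs_le_of_sq_le_sq (h2.trans h) (norm_nonneg _)

lemma norm_le_sum_abs (A : Matrix (Fin m) (Fin n) ℝ) : ‖A‖ ≤ ∑ i, ∑ j, |A i j| := by
  rw [Matrix.l2_opNorm_def]
  refine ContinuousLinearMap.opNorm_le_bound _
    (Finset.sum_nonneg fun i _ => Finset.sum_nonneg fun j _ => abs_nonneg _) fun x => ?_
  have hx : ∀ j, |x j| ≤ ‖x‖ := fun j => PiLp.norm_apply_le x j
  have hy : ∀ y : EuclideanSpace ℝ (Fin m), ‖y‖ ≤ ∑ i, |y i| := fun y => by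
    rw [EuclideanSpace.norm_eq]
    refine Real.sqrt_le_iff.2 ⟨Finset.sum_nonneg fun i _ => abs_nonneg _, ?_⟩
    simpa using Finset.sum_sq_le_sq_sum_of_nonneg (s := Finset.univ) (f := fun i => |y i|)
      (fun i _ => abs_nonneg _)
  refine (hy _).trans ?_
  rw [Finset.sum_mul]
  refine Finset.sum_le_sum fun i _ => ?_
  have : (Matrix.toEuclideanLin (𝕜 := ℝ) A x) i = ∑ j, A i j * x j := by
    simp [Matrix.toEuclideanLin, Matrix.mulVec, dotProduct]
  simp only [LinearEquiv.trans_apply, LinearMap.coe_toContinuousLinearMap', this]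
  rw [Finset.sum_mul]
  refine (Finset.abs_sum_le_sum_abs _ _).trans (Finset.sum_le_sum fun j _ => ?_)
  rw [abs_mul]
  gcongr
  exact hx j

end Norm

/-! ### First and second moments of one error step, with error and minimizer frozen -/

section Step

variable {d : ℕ} {p : unitInterval}

/-- One step of the recursion satisfied by the difference `u` of the iterate and the
minimizer `v` of the marginalized loss. -/
noncomputable def errStep (G H : Matrix (Fin d) (Fin d) ℝ) (α p : ℝ)
    (δ u v : Fin d → ℝ) : Fin d → ℝ :=
  u - α • (δ * (G *ᵥ (δ * u))) + α • (δ * (H *ᵥ ((fun j => p - δ j) * v)))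

lemma errStep_apply (G H : Matrix (Fin d) (Fin d) ℝ) (α p : ℝ) (δ u v : Fin d → ℝ) (i : Fin d) :
    errStep G H α p δ u v i = u i - α * (δ i * ∑ j, G i j * (δ j * u j))
      + α * (δ i * ∑ j, H i j * ((p - δ j) * v j)) := by
  simp [errStep, Matrix.mulVec, dotProduct]

lemma integral_errStep (G : Matrix (Fin d) (Fin d) ℝ) {H : Matrix (Fin d) (Fin d) ℝ}
    (hH : ∀ i, H i i = 0) (α : ℝ) (u v : Fin d → ℝ) (i : Fin d) :
    ∫ δ, errStep G H α p δ u v i ∂(dropoutLaw d p)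
      = ((1 - (α * p) • offDiagScale p G) *ᵥ u) i := by
  simp only [errStep, Pi.add_apply, Pi.sub_apply, Pi.smul_apply, smul_eq_mul]
  rw [integral_add (integrable_dropoutLaw (by fun_prop)) (integrable_dropoutLaw (by fun_prop)),
    integral_sub (integrable_dropoutLaw (by fun_prop)) (integrable_dropoutLaw (by fun_prop)),
    integral_const_mul, integral_const_mul, integral_mask_mulVec_mask,
    integral_mask_mulVec_centered hH]
  simp [Matrix.sub_mulVec, Matrix.smul_mulVec, mul_assoc]

/-- The mixed moment of the two noise terms of `errStep`. -/
noncomputable def mixedMoment (G H : Matrix (Fin d) (Fin d) ℝ) (p : unitInterval) :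
    Matrix (Fin d) (Fin d) ℝ :=
  Matrix.of fun j l => ∫ δ, ∑ i, δ i * (G i j * δ j) * (δ i * (H i l * ((p : ℝ) - δ l)))
    ∂(dropoutLaw d p)

lemma integral_mixed (G H : Matrix (Fin d) (Fin d) ℝ) (u v : Fin d → ℝ) :
    ∫ δ, (δ * (G *ᵥ (δ * u))) ⬝ᵥ (δ * (H *ᵥ ((fun j => (p : ℝ) - δ j) * v))) ∂(dropoutLaw d p)
      = ∑ j, ∑ l, mixedMoment G H p j l * (u j * v l) := by
  have : ∀ δ : Fin d → ℝ,
      (δ * (G *ᵥ (δ * u))) ⬝ᵥ (δ * (H *ᵥ ((fun j => (p : ℝ) - δ j) * v)))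
      = ∑ j, ∑ l, (∑ i, δ i * (G i j * δ j) * (δ i * (H i l * ((p : ℝ) - δ l)))) * (u j * v l) := by
    intro δ
    simp only [dotProduct, Pi.mul_apply, Matrix.mulVec]
    calc _ = ∑ i, ∑ j, ∑ l, δ i * (G i j * δ j) * (δ i * (H i l * ((p : ℝ) - δ l)))
          * (u j * v l) := by
          refine Finset.sum_congr rfl fun i _ => ?_
          rw [Finset.mul_sum, Finset.mul_sum, Finset.sum_mul_sum]
          exact Finset.sum_congr rfl fun j _ => Finset.sum_congr rfl fun l _ => by ring
      _ = _ := by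
          rw [Finset.sum_comm]
          refine Finset.sum_congr rfl fun j _ => ?_
          rw [Finset.sum_comm]
          exact Finset.sum_congr rfl fun l _ => (Finset.sum_mul _ _ _).symm
  simp_rw [this]
  rw [integral_finsetSum _ fun j _ => integrable_dropoutLaw (by fun_prop)]
  refine Finset.sum_congr rfl fun j _ => ?_
  rw [integral_finsetSum _ fun j _ => integrable_dropoutLaw (by fun_prop)]
  refine Finset.sum_congr rfl fun l _ => ?_
  rw [integral_mul_const]
  rfl

/-- A crude bound suffices: these coefficients multiply the cross moments of error and minimizer,
which already decay geometrically. -/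
lemma abs_mixedMoment_le (G H : Matrix (Fin d) (Fin d) ℝ) (j l : Fin d) :
    |mixedMoment G H p j l| ≤ d * (‖G‖ * ‖H‖) := by
  have h := norm_integral_le_of_norm_le_const (μ := dropoutLaw d p) (C := d * (‖G‖ * ‖H‖))
    (f := fun δ => ∑ i, δ i * (G i j * δ j) * (δ i * (H i l * ((p : ℝ) - δ l)))) (by
    filter_upwards [ae_dropoutLaw] with δ hδ
    have h1 : ∀ i, |δ i| ≤ 1 := fun i => by rcases hδ i with h | h <;> simp [h]
    have h2 : |(p : ℝ) - δ l| ≤ 1 := by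
      have := p.2.1; have := p.2.2
      rcases hδ l with h | h <;> rw [h, abs_le] <;> constructor <;> linarith
    refine (norm_sum_le _ _).trans ?_
    have : ∀ i ∈ Finset.univ, ‖δ i * (G i j * δ j) * (δ i * (H i l * ((p : ℝ) - δ l)))‖
        ≤ ‖G‖ * ‖H‖ := by
      intro i _
      simp only [Real.norm_eq_abs, abs_mul]
      have hG := abs_apply_le_norm G i j
      have hH := abs_apply_le_norm H i l
      calc |δ i| * (|G i j| * |δ j|) * (|δ i| * (|H i l| * |(p : ℝ) - δ l|))
          ≤ 1 * (‖G‖ * 1) * (1 * (‖H‖ * 1)) := by gcongr <;> exact h1 _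
        _ = _ := by ring
    simpa using Finset.sum_le_sum this)
  simpa [mixedMoment] using h

/-- For `i ≠ j`, `E[δ i (p - δ j)²] = p · p(1 - p)`. One factor `p` and the factor `1 - p` are later
cancelled by the contraction rate; the other `p` survives in the final bound. -/
lemma integral_sq_mask_centered_le {H : Matrix (Fin d) (Fin d) ℝ} (hH : ∀ i, H i i = 0)
    (v : Fin d → ℝ) :
    ∫ δ, (δ * (H *ᵥ ((fun j => (p : ℝ) - δ j) * v))) ⬝ᵥ
        (δ * (H *ᵥ ((fun j => (p : ℝ) - δ j) * v))) ∂(dropoutLaw d p)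
      ≤ (p : ℝ) ^ 2 * (1 - p) * (d * d * ‖H‖ ^ 2) * (v ⬝ᵥ v) := by
  have key : ∀ i, ∫ δ, (δ * (H *ᵥ ((fun j => (p : ℝ) - δ j) * v))) i *
      (δ * (H *ᵥ ((fun j => (p : ℝ) - δ j) * v))) i ∂(dropoutLaw d p)
      ≤ (p : ℝ) ^ 2 * (1 - p) * (d * ‖H‖ ^ 2) * (v ⬝ᵥ v) := by
    intro i
    calc _ ≤ ∫ δ, d * ∑ j, (H i j * v j) ^ 2 * (δ i * δ i * ((p : ℝ) - δ j) ^ 2)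
          ∂(dropoutLaw d p) := by
          refine integral_mono (integrable_dropoutLaw (by fun_prop))
            (integrable_dropoutLaw (by fun_prop)) fun δ => ?_
          -- Cauchy–Schwarz decouples the coordinates at the cost of a factor `d`.
          have := sq_sum_le_card_mul_sum_sq (s := Finset.univ)
            (f := fun j => δ i * (H i j * (((p : ℝ) - δ j) * v j)))
          simp only [Pi.mul_apply, Matrix.mulVec, dotProduct]
          rw [← sq, Finset.mul_sum]
          refine this.trans (le_of_eq ?_)
          simp only [Finset.card_univ, Fintype.card_fin, Finset.mul_sum]
          exact Finset.sum_congr rfl fun j _ => by ring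
      _ = d * ∑ j, (H i j * v j) ^ 2 * ((p : ℝ) ^ 2 * (1 - p)) := by
          rw [integral_const_mul, integral_finsetSum _ fun j _ => integrable_dropoutLaw (by fun_prop)]
          congr 1
          refine Finset.sum_congr rfl fun j _ => ?_
          by_cases h : i = j
          · subst h; simp [hH]
          rw [integral_const_mul]
          congr 1
          have : ∫ δ, δ i * δ i * ((p : ℝ) - δ j) ^ 2 ∂(dropoutLaw d p)
              = ∫ δ, (p : ℝ) ^ 2 * δ i + (1 - 2 * p) * (δ i * δ j) ∂(dropoutLaw d p) := by
            refine integral_congr_ae ?_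
            filter_upwards [ae_dropoutLaw] with δ hδ
            rcases hδ i with h | h <;> rcases hδ j with h' | h' <;> (simp only [h, h']; ring)
          rw [this, integral_add (integrable_dropoutLaw (by fun_prop))
            (integrable_dropoutLaw (by fun_prop)), integral_const_mul, integral_const_mul,
            integral_coord, integral_coord_mul_coord h]
          ring
      _ ≤ d * ∑ j, ‖H‖ ^ 2 * (v j * v j) * ((p : ℝ) ^ 2 * (1 - p)) := by
          have h0 : 0 ≤ 1 - (p : ℝ) := sub_nonneg.2 p.2.2
          gcongr with j _
          rw [mul_pow, ← sq]
          gcongr ?_ * _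
          exact sq_le_sq.2 ((abs_apply_le_norm H i j).trans (le_abs_self _))
      _ = _ := by
          rw [← Finset.sum_mul, ← Finset.mul_sum, ← dotProduct]; ring
  simp only [dotProduct] at key ⊢
  rw [integral_finsetSum _ fun j _ => integrable_dropoutLaw (by fun_prop)]
  refine (Finset.sum_le_sum fun i _ => key i).trans (le_of_eq ?_)
  simp only [Finset.sum_const, Finset.card_univ, Fintype.card_fin, nsmul_eq_mul]
  ring

lemma integral_sq_errStep_le (G : Matrix (Fin d) (Fin d) ℝ) {H : Matrix (Fin d) (Fin d) ℝ}
    (hH : ∀ i, H i i = 0) {α l : ℝ} (hα : 0 < α)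
    (hl : ∀ u : Fin d → ℝ, l * (u ⬝ᵥ u) ≤ u ⬝ᵥ (offDiagScale p G *ᵥ u)) (u v : Fin d → ℝ) :
    ∫ δ, errStep G H α p δ u v ⬝ᵥ errStep G H α p δ u v ∂(dropoutLaw d p)
      ≤ (1 - 2 * (α * p * l) + α ^ 2 * p * ‖G‖ ^ 2) * (u ⬝ᵥ u)
        - 2 * α ^ 2 * ∑ j, ∑ l, mixedMoment G H p j l * (u j * v l)
        + α ^ 2 * ((p : ℝ) ^ 2 * (1 - p) * (d * d * ‖H‖ ^ 2) * (v ⬝ᵥ v)) := by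
  have hexp : ∀ δ, errStep G H α p δ u v ⬝ᵥ errStep G H α p δ u v
      = u ⬝ᵥ u - 2 * α * ((δ * u) ⬝ᵥ (G *ᵥ (δ * u)))
        + α ^ 2 * ((δ * (G *ᵥ (δ * u))) ⬝ᵥ (δ * (G *ᵥ (δ * u))))
        + 2 * α * (u ⬝ᵥ (δ * (H *ᵥ ((fun j => (p : ℝ) - δ j) * v))))
        - 2 * α ^ 2 * ((δ * (G *ᵥ (δ * u))) ⬝ᵥ (δ * (H *ᵥ ((fun j => (p : ℝ) - δ j) * v))))
        + α ^ 2 * ((δ * (H *ᵥ ((fun j => (p : ℝ) - δ j) * v))) ⬝ᵥ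
            (δ * (H *ᵥ ((fun j => (p : ℝ) - δ j) * v)))) := by
    intro δ
    simp only [errStep]
    generalize H *ᵥ ((fun j => (p : ℝ) - δ j) * v) = w
    generalize G *ᵥ (δ * u) = z
    simp only [dotProduct, Pi.add_apply, Pi.sub_apply, Pi.smul_apply, Pi.mul_apply, smul_eq_mul,
      Finset.mul_sum, ← Finset.sum_add_distrib, ← Finset.sum_sub_distrib]
    exact Finset.sum_congr rfl fun i _ => by ring
  -- The outer mask only shrinks the norm and is dropped; the inner one is kept, since it supplies
  -- the factor `p` that makes this term comparable with `α p l`.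
  have hG : ∫ δ, (δ * (G *ᵥ (δ * u))) ⬝ᵥ (δ * (G *ᵥ (δ * u))) ∂(dropoutLaw d p)
      ≤ ‖G‖ ^ 2 * (p * (u ⬝ᵥ u)) := by
    rw [← integral_sum_sq_mask, ← integral_const_mul]
    refine integral_mono_ae (integrable_dropoutLaw (by fun_prop))
      (integrable_dropoutLaw (by fun_prop)) ?_
    filter_upwards [ae_dropoutLaw] with δ hδ
    refine le_trans ?_ (mulVec_dotProduct_self_le G (δ * u))
    generalize G *ᵥ (δ * u) = z
    refine Finset.sum_le_sum fun i _ => ?_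
    rcases hδ i with h | h <;> simp [h, mul_self_nonneg]
  have hc : ∫ δ, u ⬝ᵥ (δ * (H *ᵥ ((fun j => (p : ℝ) - δ j) * v))) ∂(dropoutLaw d p) = 0 := by
    rw [integral_dotProduct _ (by fun_prop)]
    exact Finset.sum_eq_zero fun i _ =>
      mul_eq_zero_of_right _ (integral_mask_mulVec_centered hH v i)
  have hI := @integrable_dropoutLaw d p
  simp_rw [hexp]
  rw [integral_add (hI (by fun_prop)) (hI (by fun_prop)),
    integral_sub (hI (by fun_prop)) (hI (by fun_prop)),
    integral_add (hI (by fun_prop)) (hI (by fun_prop)),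
    integral_add (hI (by fun_prop)) (hI (by fun_prop)),
    integral_sub (hI (by fun_prop)) (hI (by fun_prop))]
  simp only [integral_const_mul]
  rw [integral_mask_quadratic, integral_mixed, hc]
  have h1 := integral_sq_mask_centered_le (p := p) hH v
  have h2 := mul_le_mul_of_nonneg_left (hl u) (by have := p.2.1; positivity : 0 ≤ 2 * α * (p : ℝ))
  have h3 := mul_le_mul_of_nonneg_left h1 (sq_nonneg α)
  have h4 := mul_le_mul_of_nonneg_left hG (sq_nonneg α)
  simp only [integral_const, probReal_univ, one_smul]
  linarith

end Step

/-! ### Smallest eigenvalue of a symmetric matrix -/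

section Spectral

variable {d : ℕ} {A : Matrix (Fin d) (Fin d) ℝ}

lemma lambdaMin_mul_le (hA : A.IsHermitian) (u : Fin d → ℝ) :
    lambdaMin A * (u ⬝ᵥ u) ≤ u ⬝ᵥ (A *ᵥ u) := by
  have hs : (A - lambdaMin A • 1).PosSemidef := by
    refine Matrix.posSemidef_iff_isHermitian_and_spectrum_nonneg.2
      ⟨hA.sub (by simp [Matrix.IsHermitian]), ?_⟩
    have : lambdaMin A • (1 : Matrix (Fin d) (Fin d) ℝ)
      = algebraMap ℝ (Matrix (Fin d) (Fin d) ℝ) (lambdaMin A) := by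
      rw [Algebra.algebraMap_eq_smul_one]
    rw [this, ← spectrum.sub_singleton_eq]
    rintro _ ⟨x, hx, _, rfl, rfl⟩
    have : lambdaMin A ≤ x := csInf_le A.finite_real_spectrum.bddBelow hx
    simpa using this
  have h := hs.dotProduct_mulVec_nonneg u
  simp only [star_trivial, Matrix.sub_mulVec, Matrix.smul_mulVec, Matrix.one_mulVec,
    dotProduct_sub, dotProduct_smul, smul_eq_mul] at h
  linarith

lemma exists_eigenvector_lambdaMin (hd : 0 < d) (hA : A.IsHermitian) :
    ∃ v : Fin d → ℝ, 0 < v ⬝ᵥ v ∧ A *ᵥ v = lambdaMin A • v := by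
  have : Nonempty (Fin d) := ⟨⟨0, hd⟩⟩
  have hne : (spectrum ℝ A).Nonempty := by
    rw [hA.spectrum_real_eq_range_eigenvalues]; exact Set.range_nonempty _
  have hm : lambdaMin A ∈ spectrum ℝ A := hne.csInf_mem A.finite_real_spectrum
  rw [hA.spectrum_real_eq_range_eigenvalues] at hm
  obtain ⟨i, hi⟩ := hm
  refine ⟨hA.eigenvectorBasis i, ?_, ?_⟩
  · rw [dotProduct_self_eq_norm_sq]
    simp
  · rw [← hi]
    exact hA.mulVec_eigenvectorBasis i

lemma le_lambdaMin (hd : 0 < d) (hA : A.IsHermitian) {c : ℝ}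
    (hc : ∀ u : Fin d → ℝ, c * (u ⬝ᵥ u) ≤ u ⬝ᵥ (A *ᵥ u)) : c ≤ lambdaMin A := by
  obtain ⟨v, hv, h⟩ := exists_eigenvector_lambdaMin hd hA
  have := hc v
  rw [h, dotProduct_smul, smul_eq_mul] at this
  exact le_of_mul_le_mul_right this hv

/-- Test `1 - t • A` on an eigenvector of the smallest eigenvalue. This compares the second-moment
rate `r` with the first-moment rate `q`. -/
lemma one_sub_mul_lambdaMin_le_norm (hd : 0 < d) (hA : A.IsHermitian) (t : ℝ) :
    1 - t * lambdaMin A ≤ ‖1 - t • A‖ := by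
  obtain ⟨v, hv, h⟩ := exists_eigenvector_lambdaMin hd hA
  have h2 := mulVec_dotProduct_self_le (1 - t • A) v
  have : (1 - t • A) *ᵥ v = (1 - t * lambdaMin A) • v := by
    rw [Matrix.sub_mulVec, Matrix.one_mulVec, Matrix.smul_mulVec, h, sub_smul, one_smul, mul_smul]
  rw [this, smul_dotProduct, dotProduct_smul, smul_eq_mul, smul_eq_mul, ← mul_assoc] at h2
  have h3 := le_of_mul_le_mul_right h2 hv
  rw [← sq] at h3
  exact (le_abs_self _).trans (abs_le_of_sq_le_sq h3 (norm_nonneg _))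

end Spectral

/-! ### Gram matrix, normal equations and the error recursion -/

section Gram

variable {n d : ℕ} (X : Matrix (Fin n) (Fin d) ℝ) {p : unitInterval}

lemma gram_mulVec (u : Fin d → ℝ) : gram X *ᵥ u = Xᵀ *ᵥ (X *ᵥ u) := by
  simp [gram]

lemma gram_apply_comm (i j : Fin d) : gram X i j = gram X j i := by
  simp only [gram, Matrix.mul_apply, Matrix.transpose_apply]
  exact Finset.sum_congr rfl fun k _ => mul_comm _ _

lemma isHermitian_offDiagScale_gram : (offDiagScale p (gram X)).IsHermitian := by
  ext i j
  simp only [Matrix.conjTranspose_apply, star_trivial, offDiagScale_apply, gram_apply_comm X j i,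
    eq_comm (a := j)]

lemma dotProduct_gram_mulVec (u w : Fin d → ℝ) : u ⬝ᵥ (gram X *ᵥ w) = (X *ᵥ u) ⬝ᵥ (X *ᵥ w) := by
  rw [gram_mulVec, Matrix.dotProduct_mulVec, Matrix.vecMul_transpose]

lemma exists_le_gram_diag (hX : ∀ j, ∃ i, X i j ≠ 0) : ∃ m : ℝ, 0 < m ∧ ∀ i, m ≤ gram X i i := by
  have hpos : ∀ j, 0 < gram X j j := by
    intro j
    obtain ⟨i, hi⟩ := hX j
    simp only [gram, Matrix.mul_apply, Matrix.transpose_apply]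
    exact Finset.sum_pos' (fun _ _ => mul_self_nonneg _)
      ⟨i, Finset.mem_univ _, mul_self_pos.2 hi⟩
  rcases isEmpty_or_nonempty (Fin d) with h | h
  · exact ⟨1, one_pos, fun i => h.elim i⟩
  · obtain ⟨j, hj⟩ := Finite.exists_min fun j => gram X j j
    exact ⟨_, hpos j, hj⟩

/-- The part `p G` is positive semidefinite and is discarded; the diagonal part alone gives
coercivity, even when `G` is singular. -/
lemma le_dotProduct_offDiagScale_gram {m : ℝ} (hm : ∀ i, m ≤ gram X i i) (u : Fin d → ℝ) :
    (1 - p) * m * (u ⬝ᵥ u) ≤ u ⬝ᵥ (offDiagScale p (gram X) *ᵥ u) := by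
  have h1 : 0 ≤ u ⬝ᵥ (gram X *ᵥ u) := by
    rw [dotProduct_gram_mulVec]; exact dotProduct_self_nonneg_real _
  have h2 : m * (u ⬝ᵥ u) ≤ u ⬝ᵥ (diagPart (gram X) *ᵥ u) := by
    simp only [diagPart, dotProduct, Matrix.mulVec_diagonal, Finset.mul_sum, Matrix.diag_apply]
    refine Finset.sum_le_sum fun i _ => ?_
    nlinarith [hm i, mul_self_nonneg (u i)]
  simp only [offDiagScale, Matrix.add_mulVec, Matrix.smul_mulVec, dotProduct_add, dotProduct_smul,
    smul_eq_mul]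
  have hp := mul_nonneg p.2.1 h1
  have hq := mul_le_mul_of_nonneg_left h2 (sub_nonneg.2 p.2.2)
  linarith

/-- Test on a basis vector: `G_p` and `G` have the same diagonal. -/
lemma lambdaMin_offDiagScale_gram_le (hd : 0 < d) :
    lambdaMin (offDiagScale p (gram X)) ≤ ‖gram X‖ := by
  have h := lambdaMin_mul_le (isHermitian_offDiagScale_gram X (p := p)) (Pi.single ⟨0, hd⟩ 1)
  simp only [single_dotProduct, Pi.single_eq_same, mul_one, one_mul, Matrix.mulVec_single_one,
    Matrix.col_apply, offDiagScale_apply, if_true] at h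
  exact h.trans ((le_abs_self _).trans (abs_apply_le_norm _ _ _))

lemma marginalizedLoss_eq (y : Fin n → ℝ) (b : Fin d → ℝ) :
    marginalizedLoss X p y b = y ⬝ᵥ y - 2 * p * ((Xᵀ *ᵥ y) ⬝ᵥ b)
      + p * (b ⬝ᵥ (offDiagScale p (gram X) *ᵥ b)) := by
  have h : ∀ δ : Fin d → ℝ, ‖WithLp.toLp 2 (y - (X * Matrix.diagonal δ) *ᵥ b)‖ ^ 2
      = y ⬝ᵥ y - 2 * ((Xᵀ *ᵥ y * b) ⬝ᵥ δ) + (δ * b) ⬝ᵥ (gram X *ᵥ (δ * b)) := by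
    intro δ
    have h1 : (X * Matrix.diagonal δ) *ᵥ b = X *ᵥ (δ * b) := by
      rw [← Matrix.mulVec_mulVec]; congr 1; ext i; simp [Matrix.mulVec_diagonal]
    have h2 : (Xᵀ *ᵥ y * b) ⬝ᵥ δ = y ⬝ᵥ (X *ᵥ (δ * b)) := by
      rw [Matrix.dotProduct_mulVec, ← Matrix.mulVec_transpose]
      simp only [dotProduct, Pi.mul_apply]
      exact Finset.sum_congr rfl fun i _ => by ring
    rw [← dotProduct_self_eq_norm_sq, h1, h2, dotProduct_gram_mulVec, sub_dotProduct,
      dotProduct_sub, dotProduct_sub, dotProduct_comm (X *ᵥ (δ * b)) y]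
    ring
  have hI := @integrable_dropoutLaw d p
  simp only [marginalizedLoss, h]
  rw [integral_add (hI (by fun_prop)) (hI (by fun_prop)),
    integral_sub (hI (by fun_prop)) (hI (by fun_prop)), integral_mask_quadratic,
    integral_const_mul, integral_dotProduct _ (by fun_prop)]
  simp_rw [integral_coord]
  simp only [integral_const, probReal_univ, one_smul]
  congr 2
  simp only [dotProduct, Pi.mul_apply, Finset.mul_sum]
  exact Finset.sum_congr rfl fun i _ => by ring

lemma offDiagScale_gram_mulVec_minimizer {b : (Fin n → ℝ) → (Fin d → ℝ)} (hp : 0 < p)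
    (hb : IsMarginalizedLossMinimizer X p b) (y : Fin n → ℝ) :
    offDiagScale p (gram X) *ᵥ b y = Xᵀ *ᵥ y := by
  set S := offDiagScale p (gram X) with hS
  set g := S *ᵥ b y - Xᵀ *ᵥ y with hg
  have hsym : ∀ u w : Fin d → ℝ, u ⬝ᵥ (S *ᵥ w) = w ⬝ᵥ (S *ᵥ u) := by
    intro u w
    have : Sᵀ = S := by
      simpa [Matrix.IsHermitian] using isHermitian_offDiagScale_gram X (p := p)
    rw [Matrix.dotProduct_mulVec, ← Matrix.mulVec_transpose, this, dotProduct_comm]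
  have hp' : 0 < (p : ℝ) := hp
  -- Moving from the minimizer along the residual `g` changes the loss by `p` times this quadratic
  -- in `t`. It has no constant term, so a nonpositive discriminant forces `g ⬝ᵥ g = 0`.
  have hquad : ∀ t : ℝ, 0 ≤ (g ⬝ᵥ (S *ᵥ g)) * (t * t) + 2 * (g ⬝ᵥ g) * t + 0 := by
    intro t
    have h := hb y (Set.mem_univ (b y + t • g))
    simp only [Set.mem_ofPred_eq, marginalizedLoss_eq, ← hS, Matrix.mulVec_add, Matrix.mulVec_smul,
      dotProduct_add, add_dotProduct, dotProduct_smul, smul_dotProduct, smul_eq_mul] at h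
    rw [hsym (b y) g] at h
    have hgg : g ⬝ᵥ g = g ⬝ᵥ (S *ᵥ b y) - (Xᵀ *ᵥ y) ⬝ᵥ g := by
      nth_rewrite 2 [hg]; rw [dotProduct_sub, dotProduct_comm g (Xᵀ *ᵥ y)]
    rw [hgg]
    refine nonneg_of_mul_nonneg_right (b := _) (a := (p : ℝ)) ?_ hp'
    linarith
  have h := discrim_le_zero hquad
  have : g ⬝ᵥ g = 0 := by
    simp only [discrim, mul_zero, sub_zero] at h
    have := pow_eq_zero_iff (two_ne_zero) |>.1 (le_antisymm h (sq_nonneg _))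
    linarith
  exact sub_eq_zero.1 (dotProduct_self_eq_zero.1 this)

/-- The off-diagonal part of the Gram matrix. -/
noncomputable def gramOff : Matrix (Fin d) (Fin d) ℝ := gram X - diagPart (gram X)

lemma gramOff_apply_self (i : Fin d) : gramOff X i i = 0 := by
  simp [gramOff, diagPart]

/-- Replacing `Xᵀ y` by `G_p v` turns the forcing term into `D (G_p - G D) v`. Its diagonal part
vanishes because `D² = D`, leaving `D H (p - D) v`. -/
lemma step_sub_eq_errStep {δ : Fin d → ℝ} (hδ : ∀ i, δ i = 1 ∨ δ i = 0) (α : ℝ)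
    {y : Fin n → ℝ} {v : Fin d → ℝ} (hv : offDiagScale p (gram X) *ᵥ v = Xᵀ *ᵥ y)
    (b : Fin d → ℝ) :
    b + α • ((Matrix.diagonal δ * Xᵀ) *ᵥ (y - (X * Matrix.diagonal δ) *ᵥ b)) - v
      = errStep (gram X) (gramOff X) α p δ (b - v) v := by
  have hD : ∀ u, Matrix.diagonal δ *ᵥ u = δ * u := fun u => by
    ext i; simp [Matrix.mulVec_diagonal]
  rw [← Matrix.mulVec_mulVec, ← Matrix.mulVec_mulVec, Matrix.mulVec_sub, ← gram_mulVec, hD, hD,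
    ← hv, errStep]
  have key : δ * (offDiagScale p (gram X) *ᵥ v) - δ * (gram X *ᵥ (δ * v))
      = δ * (gramOff X *ᵥ ((fun j => (p : ℝ) - δ j) * v)) := by
    ext i
    simp only [Pi.mul_apply, Pi.sub_apply, Matrix.mulVec, dotProduct, Finset.mul_sum,
      ← Finset.sum_sub_distrib]
    refine Finset.sum_congr rfl fun j _ => ?_
    rw [offDiagScale_apply]
    by_cases h : i = j
    · subst h
      simp only [if_true, gramOff_apply_self]
      rcases hδ i with h | h <;> simp [h]
    · simp only [h, if_false, gramOff, diagPart, Matrix.sub_apply, Matrix.diagonal_apply]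
      ring
  rw [← key, mul_sub, mul_sub, Matrix.mulVec_sub, mul_sub, smul_sub, smul_sub, smul_sub]
  abel

/-- With `c = (1 - p) m`, combine `c ‖v‖² ≤ ⟨v, w⟩` with `0 ≤ ‖w - c v‖²`. This is the source of `(1
- p)⁻²` in the theorem. -/
lemma dotProduct_self_le_of_offDiagScale_mulVec {m : ℝ} (hm0 : 0 < m)
    (hm : ∀ i, m ≤ gram X i i) (hp : p < 1) {v w : Fin d → ℝ}
    (hv : offDiagScale p (gram X) *ᵥ v = w) :
    v ⬝ᵥ v ≤ (w ⬝ᵥ w) / m ^ 2 / (1 - p) ^ 2 := by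
  have h := le_dotProduct_offDiagScale_gram X hm v (p := p)
  rw [hv] at h
  have hp' : 0 < 1 - (p : ℝ) := sub_pos.2 hp
  have hc : 0 < (1 - (p : ℝ)) * m := mul_pos hp' hm0
  have h2 : 0 ≤ (w - ((1 - (p : ℝ)) * m) • v) ⬝ᵥ (w - ((1 - (p : ℝ)) * m) • v) :=
    dotProduct_self_nonneg_real _
  rw [sub_dotProduct, dotProduct_sub, dotProduct_sub, smul_dotProduct, dotProduct_smul,
    smul_dotProduct, dotProduct_smul, dotProduct_comm w v] at h2
  simp only [smul_eq_mul] at h2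
  rw [div_div, le_div_iff₀ (by positivity)]
  have h3 := mul_le_mul_of_nonneg_left h hc.le
  have e : m ^ 2 * (1 - (p : ℝ)) ^ 2 = ((1 - p) * m) * ((1 - p) * m) := by ring
  rw [e]
  linarith

end Gram

/-! ### Independence of a fresh mask from the past -/

section Independence

variable {Ω : Type*} [MeasurableSpace Ω] {μ : Measure Ω} [IsProbabilityMeasure μ]

/-- Both hypotheses factor the joint law, so the claim is associativity of product measures. -/
lemma IndepFun.assoc {E F K : Type*} [MeasurableSpace E] [MeasurableSpace F] [MeasurableSpace K]
    {A : Ω → E} {B : Ω → F} {C : Ω → K} (hA : AEMeasurable A μ) (hB : AEMeasurable B μ)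
    (hC : AEMeasurable C μ) (hAB : IndepFun A B μ) (hABC : IndepFun (fun ω => (A ω, B ω)) C μ) :
    IndepFun A (fun ω => (B ω, C ω)) μ := by
  have hBC : IndepFun B C μ := hABC.comp measurable_snd measurable_id
  have := Measure.isProbabilityMeasure_map hA
  have := Measure.isProbabilityMeasure_map hB
  have := Measure.isProbabilityMeasure_map hC
  rw [indepFun_iff_map_prod_eq_prod_map_map hA (hB.prodMk hC),
    (indepFun_iff_map_prod_eq_prod_map_map hB hC).1 hBC, ← Measure.prodAssoc_prod,
    ← (indepFun_iff_map_prod_eq_prod_map_map hA hB).1 hAB,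
    ← (indepFun_iff_map_prod_eq_prod_map_map (hA.prodMk hB) hC).1 hABC,
    AEMeasurable.map_map_of_aemeasurable (MeasurableEquiv.measurable _).aemeasurable
      ((hA.prodMk hB).prodMk hC)]
  rfl

lemma indepFun_history {E K : Type*} [MeasurableSpace E] [MeasurableSpace K]
    {δ : ℕ → Ω → E} {Z : Ω → K} (hδ : ∀ k, AEMeasurable (δ k) μ) (hZ : AEMeasurable Z μ)
    (hind : iIndepFun δ μ) (h : IndepFun (fun ω k => δ k ω) Z μ) (k : ℕ) :
    IndepFun (δ k) (fun ω => ((fun j : Finset.range k => δ j ω), Z ω)) μ := by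
  have hB : AEMeasurable (fun ω => (fun j : Finset.range k => δ j ω)) μ :=
    aemeasurable_pi_lambda _ fun j => hδ j
  refine IndepFun.assoc (hδ k) hB hZ ?_ ?_
  · have h1 := hind.indepFun_finset₀ {k} (Finset.range k) (by simp) hδ
    have hφ : Measurable fun f : ({k} : Finset ℕ) → E => f ⟨k, by simp⟩ := measurable_pi_apply _
    exact h1.comp hφ measurable_id
  · have hφ : Measurable fun f : ℕ → E => (f k, fun j : Finset.range k => f j) :=
      (measurable_pi_apply _).prodMk (measurable_pi_lambda _ fun j => measurable_pi_apply _)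
    exact h.comp hφ measurable_id

/-- Fubini for the product law; it plays the role of conditioning on `Z`. -/
lemma integral_indep {E K : Type*} [MeasurableSpace E] [MeasurableSpace K]
    {ρ : Measure E} [IsProbabilityMeasure ρ] {δ : Ω → E} {Z : Ω → K} (hδ : HasLaw δ ρ μ)
    (hZ : AEMeasurable Z μ) (h : IndepFun δ Z μ) {f : E × K → ℝ} (hf : Measurable f)
    (hint : Integrable (fun ω => f (δ ω, Z ω)) μ) :
    Integrable (fun ω => ∫ x, f (x, Z ω) ∂ρ) μ ∧
      ∫ ω, f (δ ω, Z ω) ∂μ = ∫ ω, ∫ x, f (x, Z ω) ∂ρ ∂μ := by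
  have := Measure.isProbabilityMeasure_map hZ
  have hmap : μ.map (fun ω => (δ ω, Z ω)) = ρ.prod (μ.map Z) := by
    rw [(indepFun_iff_map_prod_eq_prod_map_map hδ.aemeasurable hZ).1 h, hδ.map_eq]
  have hm : AEMeasurable (fun ω => (δ ω, Z ω)) μ := hδ.aemeasurable.prodMk hZ
  have hint' : Integrable f (ρ.prod (μ.map Z)) := by
    rw [← hmap]
    exact (integrable_map_measure hf.aestronglyMeasurable hm).2 hint
  have hfz : Integrable (fun z => ∫ x, f (x, z) ∂ρ) (μ.map Z) := hint'.integral_prod_right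
  refine ⟨(integrable_map_measure hfz.1 hZ).1 hfz, ?_⟩
  rw [← integral_map (f := f) hm hf.aestronglyMeasurable, hmap, integral_prod_symm _ hint',
    integral_map hZ hfz.1]

end Independence

/-! ### Adaptedness of the iterates -/

section Iterate

variable {n d : ℕ} (X : Matrix (Fin n) (Fin d) ℝ)

lemma dropoutIterate_congr (α : ℝ) (y : Fin n → ℝ) (b₀ : Fin d → ℝ) {δ δ' : ℕ → Fin d → ℝ} (k : ℕ)
    (h : ∀ j < k, δ j = δ' j) : dropoutIterate X α y b₀ δ k = dropoutIterate X α y b₀ δ' k := by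
  induction k with
  | zero => rfl
  | succ k ih =>
    simp only [dropoutIterate]
    rw [ih fun j hj => h j (hj.trans k.lt_succ_self), h k k.lt_succ_self]

lemma continuous_dropoutIterate (α : ℝ) (k : ℕ) :
    Continuous fun q : (ℕ → Fin d → ℝ) × (Fin n → ℝ) × (Fin d → ℝ) =>
      dropoutIterate X α q.2.1 q.2.2 q.1 k := by
  induction k with
  | zero => simp only [dropoutIterate]; fun_prop
  | succ k ih => simp only [dropoutIterate]; fun_prop

lemma indepFun_dropoutIterate {Ω : Type*} [MeasurableSpace Ω] {μ : Measure Ω}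
    [IsProbabilityMeasure μ] {δ : ℕ → Ω → Fin d → ℝ} {Y : Ω → Fin n → ℝ} {β₀ : Ω → Fin d → ℝ}
    (hδ : ∀ k, AEMeasurable (δ k) μ) (hY : AEMeasurable Y μ) (hβ : AEMeasurable β₀ μ)
    (hind : iIndepFun δ μ) (h : IndepFun (fun ω k => δ k ω) (fun ω => (Y ω, β₀ ω)) μ)
    {E : Type*} [MeasurableSpace E]
    {f : (Fin d → ℝ) × (Fin n → ℝ) → E} (hf : Measurable f) (α : ℝ) (k : ℕ) :
    IndepFun (δ k) (fun ω => f (dropoutIterate X α (Y ω) (β₀ ω) (fun j => δ j ω) k, Y ω)) μ := by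
  have h1 := indepFun_history hδ (hY.prodMk hβ) hind h k
  -- The `k`-th iterate uses only the masks with index below `k`. Padding by zero makes it a
  -- measurable function of that finite history.
  let pad : (Finset.range k → Fin d → ℝ) → ℕ → Fin d → ℝ := fun g j =>
    if hj : j ∈ Finset.range k then g ⟨j, hj⟩ else 0
  have hpad : Measurable pad := by
    refine measurable_pi_lambda _ fun j => ?_
    by_cases hj : j ∈ Finset.range k
    · simp only [pad, hj, dif_pos]
      exact measurable_pi_apply _
    · simp only [pad, hj, dif_neg, not_false_eq_true]
      exact measurable_const
  have h2 := h1.comp (φ := id) (ψ := fun q =>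
    f (dropoutIterate X α q.2.1 q.2.2 (pad q.1) k, q.2.1)) measurable_id (by
      refine hf.comp (Measurable.prodMk ?_ (by fun_prop))
      exact (continuous_dropoutIterate X α k).measurable.comp
        ((hpad.comp measurable_fst).prodMk measurable_snd))
  have e : ∀ ω, dropoutIterate X α (Y ω) (β₀ ω) (fun j => δ j ω) k
      = dropoutIterate X α (Y ω) (β₀ ω) (pad fun j => δ j ω) k := fun ω =>
    dropoutIterate_congr X α _ _ k fun j hj => by simp [pad, hj]
  simp_rw [e]
  exact h2

end Iterate

/-! ### Square-integrable variables and covariances -/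

section Moments

variable {Ω : Type*} [MeasurableSpace Ω] {μ : Measure Ω}

lemma memLp_mul_of_abs_le_one {f g : Ω → ℝ} (hf : AEStronglyMeasurable f μ)
    (hb : ∀ᵐ ω ∂μ, |f ω| ≤ 1) (hg : MemLp g 2 μ) : MemLp (fun ω => f ω * g ω) 2 μ := by
  refine hg.mono (hf.mul hg.1) ?_
  filter_upwards [hb] with ω h
  rw [norm_mul]
  exact mul_le_of_le_one_left (norm_nonneg _) h

lemma integrable_dotProduct {d : ℕ} {U V : Ω → Fin d → ℝ} (hU : ∀ i, MemLp (fun ω => U ω i) 2 μ)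
    (hV : ∀ i, MemLp (fun ω => V ω i) 2 μ) : Integrable (fun ω => U ω ⬝ᵥ V ω) μ :=
  integrable_finsetSum _ fun i _ => (hU i).integrable_mul (hV i)

lemma aemeasurable_of_memLp {d : ℕ} {U : Ω → Fin d → ℝ} (hU : ∀ i, MemLp (fun ω => U ω i) 2 μ) :
    AEMeasurable U μ := aemeasurable_pi_lambda _ fun i => (hU i).1.aemeasurable

lemma abs_integral_mul_le {f g : Ω → ℝ} (hf : MemLp f 2 μ) (hg : MemLp g 2 μ) :
    |∫ ω, f ω * g ω ∂μ| ≤ (∫ ω, f ω ^ 2 ∂μ + ∫ ω, g ω ^ 2 ∂μ) / 2 := by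
  rw [← integral_add hf.integrable_sq hg.integrable_sq, ← integral_div]
  refine (abs_integral_le_integral_abs).trans (integral_mono (hf.integrable_mul hg).abs
    ((hf.integrable_sq.add hg.integrable_sq).div_const 2) fun ω => ?_)
  rw [abs_le]
  constructor <;> nlinarith [sq_nonneg (f ω + g ω), sq_nonneg (f ω - g ω)]

lemma integral_sq_le_integral_dotProduct {d : ℕ} {U : Ω → Fin d → ℝ}
    (hU : ∀ i, MemLp (fun ω => U ω i) 2 μ) (i : Fin d) :
    ∫ ω, U ω i ^ 2 ∂μ ≤ ∫ ω, U ω ⬝ᵥ U ω ∂μ :=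
  integral_mono (hU i).integrable_sq (integrable_dotProduct hU hU)
    fun ω => sq_le_dotProduct_self (U ω) i

variable [IsProbabilityMeasure μ]

lemma integral_sub_mean_sq_le {f : Ω → ℝ} (hf : MemLp f 2 μ) :
    ∫ ω, (f ω - ∫ x, f x ∂μ) ^ 2 ∂μ ≤ ∫ ω, f ω ^ 2 ∂μ := by
  have h := variance_le_expectation_sq hf.1
  rw [variance_eq_integral hf.1.aemeasurable] at h
  simpa using h

lemma memLp_sub_mean {f : Ω → ℝ} (hf : MemLp f 2 μ) :
    MemLp (fun ω => f ω - ∫ x, f x ∂μ) 2 μ := hf.sub (memLp_const _)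

lemma abs_covariance_le {f g : Ω → ℝ} (hf : MemLp f 2 μ) (hg : MemLp g 2 μ) :
    |cov[f, g; μ]| ≤ (∫ ω, f ω ^ 2 ∂μ + ∫ ω, g ω ^ 2 ∂μ) / 2 := by
  have h := abs_integral_mul_le (memLp_sub_mean hf) (memLp_sub_mean hg)
  have h1 := integral_sub_mean_sq_le hf
  have h2 := integral_sub_mean_sq_le hg
  rw [covariance]
  linarith

lemma covariance_eq_integral_mul_sub_mean {f g : Ω → ℝ} (hf : MemLp f 2 μ) (hg : MemLp g 2 μ) :
    cov[f, g; μ] = ∫ ω, f ω * (g ω - ∫ x, g x ∂μ) ∂μ := by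
  have h1 : Integrable (fun ω => f ω * (g ω - ∫ x, g x ∂μ)) μ :=
    hf.integrable_mul (memLp_sub_mean hg)
  have h2 : Integrable (fun ω => (∫ x, f x ∂μ) * (g ω - ∫ x, g x ∂μ)) μ :=
    ((memLp_sub_mean hg).integrable one_le_two).const_mul _
  rw [covariance]
  simp_rw [sub_mul]
  rw [integral_sub h1 h2, integral_const_mul,
    integral_sub (hg.integrable one_le_two) (integrable_const _)]
  simp

end Moments

/-! ### One random error step -/

section Chain

variable {Ω : Type*} [MeasurableSpace Ω] {μ : Measure Ω}
  {d : ℕ} {p : unitInterval} {G H : Matrix (Fin d) (Fin d) ℝ} {α : ℝ}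

lemma memLp_errStep {δ U V : Ω → Fin d → ℝ} (hδ : HasLaw δ (dropoutLaw d p) μ)
    (hU : ∀ i, MemLp (fun ω => U ω i) 2 μ) (hV : ∀ i, MemLp (fun ω => V ω i) 2 μ) (i : Fin d) :
    MemLp (fun ω => errStep G H α p (δ ω) (U ω) (V ω) i) 2 μ := by
  have hm : ∀ j, AEStronglyMeasurable (fun ω => δ ω j) μ := fun j =>
    ((measurable_pi_apply j).comp_aemeasurable hδ.aemeasurable).aestronglyMeasurable
  have hae : ∀ᵐ ω ∂μ, ∀ j, δ ω j = 1 ∨ δ ω j = 0 := by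
    have h := ae_dropoutLaw (d := d) (p := p)
    rw [← hδ.map_eq] at h
    exact ae_of_ae_map hδ.aemeasurable h
  have hb : ∀ j, ∀ᵐ ω ∂μ, |δ ω j| ≤ 1 := fun j => by
    filter_upwards [hae] with ω h
    rcases h j with h | h <;> simp [h]
  have hb' : ∀ j, ∀ᵐ ω ∂μ, |(p : ℝ) - δ ω j| ≤ 1 := fun j => by
    filter_upwards [hae] with ω h
    have := p.2.1; have := p.2.2
    rcases h j with h | h <;> rw [h, abs_le] <;> constructor <;> linarith
  simp only [errStep_apply]
  refine ((hU i).sub (MemLp.const_mul ?_ _)).add (MemLp.const_mul ?_ _)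
  · exact memLp_mul_of_abs_le_one (hm i) (hb i) (memLp_finsetSum _ fun j _ =>
      (memLp_mul_of_abs_le_one (hm j) (hb j) (hU j)).const_mul _)
  · exact memLp_mul_of_abs_le_one (hm i) (hb i) (memLp_finsetSum _ fun j _ =>
      (memLp_mul_of_abs_le_one (aestronglyMeasurable_const.sub (hm j)) (hb' j) (hV j)).const_mul _)

variable [IsProbabilityMeasure μ]

lemma continuous_errStep (G H : Matrix (Fin d) (Fin d) ℝ) (α p : ℝ) :
    Continuous fun q : (Fin d → ℝ) × (Fin d → ℝ) × (Fin d → ℝ) =>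
      errStep G H α p q.1 q.2.1 q.2.2 := by
  unfold errStep; fun_prop

/-- The weight `φ (V ω)` is untouched by averaging over the mask. General `φ` is needed because both
raw and centred coordinates of the minimizer occur later. -/
lemma integral_errStep_mul {δ U V : Ω → Fin d → ℝ} (hH : ∀ i, H i i = 0)
    (hδ : HasLaw δ (dropoutLaw d p) μ)
    (hU : ∀ i, MemLp (fun ω => U ω i) 2 μ) (hV : ∀ i, MemLp (fun ω => V ω i) 2 μ)
    (hind : IndepFun δ (fun ω => (U ω, V ω)) μ) {φ : (Fin d → ℝ) → ℝ} (hφ : Continuous φ)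
    (hφ2 : MemLp (fun ω => φ (V ω)) 2 μ) (i : Fin d) :
    ∫ ω, errStep G H α p (δ ω) (U ω) (V ω) i * φ (V ω) ∂μ
      = ((1 - (α * p) • offDiagScale p G) *ᵥ fun l => ∫ ω, U ω l * φ (V ω) ∂μ) i := by
  have hc := continuous_errStep G H α p
  have h := (integral_indep hδ ((aemeasurable_of_memLp hU).prodMk (aemeasurable_of_memLp hV)) hind
    (f := fun q => errStep G H α p q.1 q.2.1 q.2.2 i * φ q.2.2)
    (by fun_prop : Continuous _).measurable
    ((memLp_errStep hδ hU hV i).integrable_mul hφ2)).2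
  simp only [integral_mul_const, integral_errStep _ hH] at h
  rw [h]
  generalize (1 - (α * p) • offDiagScale p G) = P
  have hI : ∀ j, Integrable (fun ω => P i j * (U ω j * φ (V ω))) μ := fun j =>
    ((hU j).integrable_mul hφ2).const_mul _
  simp only [Matrix.mulVec, dotProduct, Finset.sum_mul, mul_assoc]
  rw [integral_finsetSum _ fun j _ => hI j]
  exact Finset.sum_congr rfl fun j _ => integral_const_mul _ _

lemma integral_errStep_sq_le {δ U V : Ω → Fin d → ℝ} (hH : ∀ i, H i i = 0)
    (hδ : HasLaw δ (dropoutLaw d p) μ)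
    (hU : ∀ i, MemLp (fun ω => U ω i) 2 μ) (hV : ∀ i, MemLp (fun ω => V ω i) 2 μ)
    (hind : IndepFun δ (fun ω => (U ω, V ω)) μ) {l : ℝ} (hα : 0 < α)
    (hl : ∀ u : Fin d → ℝ, l * (u ⬝ᵥ u) ≤ u ⬝ᵥ (offDiagScale p G *ᵥ u)) :
    ∫ ω, errStep G H α p (δ ω) (U ω) (V ω) ⬝ᵥ errStep G H α p (δ ω) (U ω) (V ω) ∂μ
      ≤ (1 - 2 * (α * p * l) + α ^ 2 * p * ‖G‖ ^ 2) * ∫ ω, U ω ⬝ᵥ U ω ∂μ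
        - 2 * α ^ 2 * ∑ j, ∑ l, mixedMoment G H p j l * ∫ ω, U ω j * V ω l ∂μ
        + α ^ 2 * ((p : ℝ) ^ 2 * (1 - p) * (d * d * ‖H‖ ^ 2) * ∫ ω, V ω ⬝ᵥ V ω ∂μ) := by
  have hc := continuous_errStep G H α p
  have hE := fun i => memLp_errStep (G := G) (H := H) (α := α) hδ hU hV i
  have h := integral_indep hδ ((aemeasurable_of_memLp hU).prodMk (aemeasurable_of_memLp hV)) hind
    (f := fun q => errStep G H α p q.1 q.2.1 q.2.2 ⬝ᵥ errStep G H α p q.1 q.2.1 q.2.2)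
    (by fun_prop : Continuous _).measurable (integrable_dotProduct hE hE)
  have hUU := integrable_dotProduct hU hU
  have hVV := integrable_dotProduct hV hV
  have hUV : ∀ j l, Integrable (fun ω => mixedMoment G H p j l * (U ω j * V ω l)) μ :=
    fun j l => ((hU j).integrable_mul (hV l)).const_mul _
  have hS : Integrable (fun ω => ∑ j, ∑ l, mixedMoment G H p j l * (U ω j * V ω l)) μ :=
    integrable_finsetSum _ fun j _ => integrable_finsetSum _ fun l _ => hUV j l
  have hSi : ∫ ω, ∑ j, ∑ l, mixedMoment G H p j l * (U ω j * V ω l) ∂μ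
      = ∑ j, ∑ l, mixedMoment G H p j l * ∫ ω, U ω j * V ω l ∂μ := by
    rw [integral_finsetSum _ fun j _ => integrable_finsetSum _ fun l _ => hUV j l]
    refine Finset.sum_congr rfl fun j _ => ?_
    rw [integral_finsetSum _ fun l _ => hUV j l]
    exact Finset.sum_congr rfl fun l _ => integral_const_mul _ _
  rw [h.2, ← hSi]
  refine (integral_mono h.1 ((((hUU.const_mul _).sub (hS.const_mul (2 * α ^ 2)))).add
    ((hVV.const_mul _).const_mul _))
    fun ω => integral_sq_errStep_le G hH hα hl (U ω) (V ω)).trans (le_of_eq ?_)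
  simp only [Pi.add_apply, Pi.sub_apply]
  rw [integral_add, integral_sub, integral_const_mul, integral_const_mul, integral_const_mul,
    integral_const_mul]
  · exact hUU.const_mul _
  · exact hS.const_mul _
  · exact (hUU.const_mul _).sub (hS.const_mul _)
  · exact (hVV.const_mul _).const_mul _

end Chain

/-! ### Deterministic recursions -/

section Recursion

lemma abs_le_of_linear_recursion {d : ℕ} {P : Matrix (Fin d) (Fin d) ℝ} {c : ℕ → Fin d → ℝ}
    (hc : ∀ k, c (k + 1) = P *ᵥ c k) {B : ℝ} (hB : 0 ≤ B) (h0 : ∀ i, |c 0 i| ≤ B) (k : ℕ)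
    (i : Fin d) : |c k i| ≤ ‖P‖ ^ k * (d * B) := by
  have h : ∀ k, c k ⬝ᵥ c k ≤ (‖P‖ ^ k * (d * B)) ^ 2 := by
    intro k
    induction k with
    | zero =>
      calc c 0 ⬝ᵥ c 0 ≤ ∑ _i : Fin d, B ^ 2 := by
            refine Finset.sum_le_sum fun i _ => ?_
            rw [← sq]
            exact sq_le_sq.2 ((h0 i).trans (le_abs_self _))
        -- Enlarging `d` to `d²` avoids a square root in the bound.
        _ = d * B ^ 2 := by simp
        _ ≤ _ := by
            rw [pow_zero, one_mul, mul_pow]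
            gcongr
            exact_mod_cast Nat.le_self_pow two_ne_zero d
    | succ k ih =>
      rw [hc]
      refine (mulVec_dotProduct_self_le P (c k)).trans ?_
      calc ‖P‖ ^ 2 * (c k ⬝ᵥ c k) ≤ ‖P‖ ^ 2 * (‖P‖ ^ k * (d * B)) ^ 2 := by gcongr
        _ = _ := by ring
  exact abs_le_of_sq_le_sq ((sq_le_dotProduct_self _ i).trans (h k)) (by positivity)

/-- `B` is a fixed point of `x ↦ r x + (1 - r) B`, so it does not accumulate, whereas the forcing
`q^k c` decays no faster than the bound `q` on `r` and picks up a factor `k`. -/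
lemma le_of_affine_recursion {a : ℕ → ℝ} {r q c B : ℝ} (hr : 0 ≤ r) (hrq : r ≤ q) (hc : 0 ≤ c)
    (ha0 : 0 ≤ a 0) (hB : 0 ≤ B) (h : ∀ k, a (k + 1) ≤ r * a k + q ^ k * c + (1 - r) * B) (k : ℕ) :
    a k ≤ q ^ k * a 0 + k * q ^ (k - 1) * c + B := by
  have hq : 0 ≤ q := hr.trans hrq
  induction k with
  | zero => simpa using hB
  | succ k ih =>
    -- At `k = 0` the truncated exponent `k - 1` is harmless because of the factor `k`.
    have h1 : k * q ^ (k - 1) * q = k * q ^ k := by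
      cases k with
      | zero => simp
      | succ k => rw [Nat.add_sub_cancel, pow_succ]; ring
    calc a (k + 1) ≤ r * (q ^ k * a 0 + k * q ^ (k - 1) * c + B) + q ^ k * c + (1 - r) * B := by
          have := mul_le_mul_of_nonneg_left ih hr
          linarith [h k]
      _ = r * (q ^ k * a 0 + k * q ^ (k - 1) * c) + q ^ k * c + B := by ring
      _ ≤ q * (q ^ k * a 0 + k * q ^ (k - 1) * c) + q ^ k * c + B := by gcongr
      _ = q ^ (k + 1) * a 0 + (k * q ^ (k - 1) * q + q ^ k) * c + B := by ring
      _ = _ := by rw [h1, Nat.add_sub_cancel]; push_cast; ring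

end Recursion

/-! ### Moment bounds along the whole error chain -/

section Chain

variable {Ω : Type*} [MeasurableSpace Ω] {μ : Measure Ω}
  {d : ℕ} {p : unitInterval} {G H : Matrix (Fin d) (Fin d) ℝ} {α : ℝ}
  {e δ : ℕ → Ω → Fin d → ℝ} {V : Ω → Fin d → ℝ}

lemma memLp_chain (hδ : ∀ k, HasLaw (δ k) (dropoutLaw d p) μ)
    (he : ∀ k, e (k + 1) =ᵐ[μ] fun ω => errStep G H α p (δ k ω) (e k ω) (V ω))
    (he0 : ∀ i, MemLp (fun ω => e 0 ω i) 2 μ) (hV : ∀ i, MemLp (fun ω => V ω i) 2 μ) (k : ℕ)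
    (i : Fin d) : MemLp (fun ω => e k ω i) 2 μ := by
  induction k generalizing i with
  | zero => exact he0 i
  | succ k ih =>
    refine (memLp_errStep (G := G) (H := H) (α := α) (hδ k) ih hV i).ae_eq ?_
    filter_upwards [he k] with ω hω
    rw [hω]

variable [IsProbabilityMeasure μ]

lemma abs_integral_chain_mul_le (hH : ∀ i, H i i = 0)
    (hδ : ∀ k, HasLaw (δ k) (dropoutLaw d p) μ)
    (he : ∀ k, e (k + 1) =ᵐ[μ] fun ω => errStep G H α p (δ k ω) (e k ω) (V ω))
    (he0 : ∀ i, MemLp (fun ω => e 0 ω i) 2 μ) (hV : ∀ i, MemLp (fun ω => V ω i) 2 μ)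
    (hind : ∀ k, IndepFun (δ k) (fun ω => (e k ω, V ω)) μ)
    {φ : (Fin d → ℝ) → ℝ} (hφ : Continuous φ) (hφ2 : MemLp (fun ω => φ (V ω)) 2 μ)
    {T : ℝ} (hT : ∫ ω, e 0 ω ⬝ᵥ e 0 ω ∂μ ≤ T) (hT0 : 0 ≤ T) (hφT : ∫ ω, φ (V ω) ^ 2 ∂μ ≤ T) (k : ℕ)
    (i : Fin d) :
    |∫ ω, e k ω i * φ (V ω) ∂μ| ≤ ‖1 - (α * p) • offDiagScale p G‖ ^ k * (d * T) := by
  refine abs_le_of_linear_recursion (c := fun k i => ∫ ω, e k ω i * φ (V ω) ∂μ) (fun k => ?_) hT0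
    (fun i => ?_) k i
  · funext i
    rw [← integral_errStep_mul hH (hδ k) (memLp_chain hδ he he0 hV k) hV (hind k) hφ hφ2 i]
    refine integral_congr_ae ?_
    filter_upwards [he k] with ω hω
    rw [hω]
  · have h1 := abs_integral_mul_le (he0 i) hφ2
    have h2 := integral_sq_le_integral_dotProduct he0 i
    linarith

lemma integral_chain_sq_le (hH : ∀ i, H i i = 0)
    (hδ : ∀ k, HasLaw (δ k) (dropoutLaw d p) μ)
    (he : ∀ k, e (k + 1) =ᵐ[μ] fun ω => errStep G H α p (δ k ω) (e k ω) (V ω))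
    (he0 : ∀ i, MemLp (fun ω => e 0 ω i) 2 μ) (hV : ∀ i, MemLp (fun ω => V ω i) 2 μ)
    (hind : ∀ k, IndepFun (δ k) (fun ω => (e k ω, V ω)) μ)
    {T : ℝ} (hT : ∫ ω, e 0 ω ⬝ᵥ e 0 ω ∂μ ≤ T) (hT0 : 0 ≤ T) (hVT : ∫ ω, V ω ⬝ᵥ V ω ∂μ ≤ T)
    {l m : ℝ} (hα : 0 < α) (hm : 0 < m) (hml : (1 - p) * m ≤ l)
    (hl : ∀ u : Fin d → ℝ, l * (u ⬝ᵥ u) ≤ u ⬝ᵥ (offDiagScale p G *ᵥ u))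
    (hαG : α * ‖G‖ ^ 2 ≤ l) (hr0 : 0 ≤ 1 - α * p * l)
    (hrq : 1 - α * p * l ≤ ‖1 - (α * p) • offDiagScale p G‖) (k : ℕ) :
    ∫ ω, e k ω ⬝ᵥ e k ω ∂μ ≤ ‖1 - (α * p) • offDiagScale p G‖ ^ k * T
      + k * ‖1 - (α * p) • offDiagScale p G‖ ^ (k - 1)
        * (2 * α ^ 2 * (d ^ 4 * (‖G‖ * ‖H‖) * T))
      + α * p * (d ^ 2 * ‖H‖ ^ 2 * T / m) := by
  set q := ‖1 - (α * p) • offDiagScale p G‖ with hq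
  have hp0 : (0 : ℝ) ≤ p := p.2.1
  have hp1 : (0 : ℝ) ≤ 1 - p := sub_nonneg.2 p.2.2
  have hmem := memLp_chain hδ he he0 hV
  have hnn : ∀ k, 0 ≤ ∫ ω, e k ω ⬝ᵥ e k ω ∂μ := fun k =>
    integral_nonneg fun ω => dotProduct_self_nonneg_real _
  have hcross : ∀ k j l, |∫ ω, e k ω j * V ω l ∂μ| ≤ q ^ k * (d * T) := fun k j l =>
    abs_integral_chain_mul_le hH hδ he he0 hV hind (φ := fun v => v l) (by fun_prop) (hV l) hT hT0
      ((integral_sq_le_integral_dotProduct hV l).trans hVT) k j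
  have hrec := le_of_affine_recursion (a := fun k => ∫ ω, e k ω ⬝ᵥ e k ω ∂μ)
    (c := 2 * α ^ 2 * (d ^ 4 * (‖G‖ * ‖H‖) * T)) (B := α * p * (d ^ 2 * ‖H‖ ^ 2 * T / m))
    hr0 hrq (by positivity) (hnn 0) (by positivity) (fun k => ?_) k
  · refine hrec.trans ?_
    gcongr
  · have h1 := integral_errStep_sq_le (G := G) hH (hδ k) (hmem k) hV (hind k) hα hl
    have h2 : ∫ ω, e (k + 1) ω ⬝ᵥ e (k + 1) ω ∂μ = ∫ ω, errStep G H α p (δ k ω) (e k ω) (V ω) ⬝ᵥ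
        errStep G H α p (δ k ω) (e k ω) (V ω) ∂μ := by
      refine integral_congr_ae ?_
      filter_upwards [he k] with ω hω
      rw [hω]
    have h3 : |∑ j, ∑ l, mixedMoment G H p j l * ∫ ω, e k ω j * V ω l ∂μ|
        ≤ q ^ k * (d ^ 4 * (‖G‖ * ‖H‖) * T) := by
      calc _ ≤ ∑ _j : Fin d, ∑ _l : Fin d, d * (‖G‖ * ‖H‖) * (q ^ k * (d * T)) := by
            refine (Finset.abs_sum_le_sum_abs _ _).trans (Finset.sum_le_sum fun j _ => ?_)
            refine (Finset.abs_sum_le_sum_abs _ _).trans (Finset.sum_le_sum fun l _ => ?_)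
            rw [abs_mul]
            gcongr
            · exact abs_mixedMoment_le G H j l
            · exact hcross k j l
        _ = _ := by simp; ring
    -- The small learning rate lets half of the drift `2αpl` absorb the quadratic term.
    have h4 : (1 - 2 * (α * p * l) + α ^ 2 * p * ‖G‖ ^ 2) * ∫ ω, e k ω ⬝ᵥ e k ω ∂μ
        ≤ (1 - α * p * l) * ∫ ω, e k ω ⬝ᵥ e k ω ∂μ := by
      refine mul_le_mul_of_nonneg_right ?_ (hnn k)
      have := mul_le_mul_of_nonneg_left hαG (mul_nonneg hα.le hp0)
      linarith
    have h5 : α ^ 2 * ((p : ℝ) ^ 2 * (1 - p) * (d * d * ‖H‖ ^ 2) * ∫ ω, V ω ⬝ᵥ V ω ∂μ)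
        ≤ (1 - (1 - α * p * l)) * (α * p * (d ^ 2 * ‖H‖ ^ 2 * T / m)) := by
      calc _ ≤ α ^ 2 * ((p : ℝ) ^ 2 * (1 - p) * (d * d * ‖H‖ ^ 2) * T) := by gcongr
        -- The noise variance is written as rate times level: `(1 - p) m ≤ l` turns the first factor
        -- into `1 - r`, and the level is `B`.
        _ = α * p * ((1 - p) * m) * (α * p * (d ^ 2 * ‖H‖ ^ 2 * T / m)) := by
            field_simp
        _ ≤ α * p * l * (α * p * (d ^ 2 * ‖H‖ ^ 2 * T / m)) := by gcongr
        _ = _ := by ring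
    have h6 := mul_le_mul_of_nonneg_left ((neg_le_abs _).trans h3)
      (by positivity : 0 ≤ 2 * α ^ 2)
    rw [h2]
    linarith

end Chain

/-! ### Covariance perturbation -/

section Covariance

variable {Ω : Type*} [MeasurableSpace Ω] {μ : Measure Ω} {m n d : ℕ}

lemma memLp_mulVec {U : Ω → Fin n → ℝ} (hU : ∀ i, MemLp (fun ω => U ω i) 2 μ)
    (A : Matrix (Fin m) (Fin n) ℝ) (i : Fin m) : MemLp (fun ω => (A *ᵥ U ω) i) 2 μ := by
  simp only [Matrix.mulVec, dotProduct]
  exact memLp_finsetSum _ fun j _ => (hU j).const_mul _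

lemma integral_mulVec_sq_le {U : Ω → Fin n → ℝ} (hU : ∀ i, MemLp (fun ω => U ω i) 2 μ)
    (A : Matrix (Fin m) (Fin n) ℝ) :
    ∫ ω, (A *ᵥ U ω) ⬝ᵥ (A *ᵥ U ω) ∂μ ≤ ‖A‖ ^ 2 * ∫ ω, U ω ⬝ᵥ U ω ∂μ := by
  rw [← integral_const_mul]
  exact integral_mono (integrable_dotProduct (memLp_mulVec hU A) (memLp_mulVec hU A))
    ((integrable_dotProduct hU hU).const_mul _) fun ω => mulVec_dotProduct_self_le A (U ω)

lemma memLp_comp_hasLaw {ν : Measure (Fin d → ℝ)} {U : Ω → Fin d → ℝ} (hU : HasLaw U ν μ)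
    {f : (Fin d → ℝ) → ℝ} (hf : MemLp f 2 ν) : MemLp (fun ω => f (U ω)) 2 μ := by
  rw [← hU.map_eq] at hf
  exact (memLp_map_measure_iff hf.1 hU.aemeasurable).1 hf

lemma integral_sub_sq_le {U V : Ω → Fin d → ℝ} (hU : ∀ i, MemLp (fun ω => U ω i) 2 μ)
    (hV : ∀ i, MemLp (fun ω => V ω i) 2 μ) :
    ∫ ω, (U ω - V ω) ⬝ᵥ (U ω - V ω) ∂μ
      ≤ 2 * ∫ ω, U ω ⬝ᵥ U ω ∂μ + 2 * ∫ ω, V ω ⬝ᵥ V ω ∂μ := by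
  have hUU := (integrable_dotProduct hU hU).const_mul 2
  have hVV := (integrable_dotProduct hV hV).const_mul 2
  have hUV : ∀ i, MemLp (fun ω => (U ω - V ω) i) 2 μ := fun i => (hU i).sub (hV i)
  rw [← integral_const_mul, ← integral_const_mul, ← integral_add hUU hVV]
  refine integral_mono (integrable_dotProduct hUV hUV) (hUU.add hVV) fun ω => ?_
  have h := dotProduct_self_nonneg_real (U ω + V ω)
  simp only [add_dotProduct, dotProduct_add] at h
  simp only [sub_dotProduct, dotProduct_sub]
  linarith

variable [IsProbabilityMeasure μ]

lemma covariance_add_add {f f' g g' : Ω → ℝ} (hf : MemLp f 2 μ) (hf' : MemLp f' 2 μ)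
    (hg : MemLp g 2 μ) (hg' : MemLp g' 2 μ) :
    cov[fun ω => f ω + f' ω, fun ω => g ω + g' ω; μ]
      = cov[f, g; μ] + cov[f, g'; μ] + cov[f', g; μ] + cov[f', g'; μ] := by
  change cov[f + f', g + g'; μ] = _
  rw [covariance_add_left hf hf' (hg.add hg'), covariance_add_right hf hg hg',
    covariance_add_right hf' hg hg']
  ring

lemma abs_covariance_perturb_le {V Z : Ω → Fin d → ℝ} (hV : ∀ i, MemLp (fun ω => V ω i) 2 μ)
    (hZ : ∀ i, MemLp (fun ω => Z ω i) 2 μ) {t T S : ℝ} (ht0 : 0 ≤ t) (ht1 : t ≤ 1)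
    (hT : ∫ ω, V ω ⬝ᵥ V ω ∂μ ≤ T) (hS : ∫ ω, Z ω ⬝ᵥ Z ω ∂μ ≤ S) (i j : Fin d) :
    |cov[fun ω => V ω i, fun ω => V ω j; μ]
      - cov[fun ω => V ω i + t * Z ω i, fun ω => V ω j + t * Z ω j; μ]| ≤ 2 * t * (T + S) := by
  have hVi := fun i => (integral_sq_le_integral_dotProduct hV i).trans hT
  have hZi := fun i => (integral_sq_le_integral_dotProduct hZ i).trans hS
  have hS0 : 0 ≤ S := (integral_nonneg fun ω => dotProduct_self_nonneg_real _).trans hS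
  have hT0 : 0 ≤ T := (integral_nonneg fun ω => dotProduct_self_nonneg_real _).trans hT
  rw [covariance_add_add (hV i) ((hZ i).const_mul t) (hV j) ((hZ j).const_mul t)]
  simp only [covariance_const_mul_left, covariance_const_mul_right]
  have h1 := abs_covariance_le (hV i) (hZ j)
  have h2 := abs_covariance_le (hZ i) (hV j)
  have h3 := abs_covariance_le (hZ i) (hZ j)
  set a := cov[fun ω => V ω i, fun ω => Z ω j; μ]
  set b := cov[fun ω => Z ω i, fun ω => V ω j; μ]
  set c := cov[fun ω => Z ω i, fun ω => Z ω j; μ]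
  have h4 : |a + b + t * c| ≤ 2 * (T + S) := by
    have h5 : |t * c| ≤ |c| := by
      rw [abs_mul, abs_of_nonneg ht0]
      exact mul_le_of_le_one_left (abs_nonneg _) ht1
    have := abs_add_le (a + b) (t * c)
    have := abs_add_le a b
    linarith [hVi i, hVi j, hZi i, hZi j]
  have e : ∀ x : ℝ, x - (x + t * a + t * b + t * (t * c)) = -(t * (a + b + t * c)) := fun x => by ring
  rw [e, abs_neg, abs_mul, abs_of_nonneg ht0]
  nlinarith

lemma covariance_linear_noise {ν : Measure (Fin n → ℝ)}
    (hν_sq : ∀ i, MemLp (fun e : Fin n → ℝ => e i) 2 ν)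
    (hν_cov : covMatrix (fun e : Fin n → ℝ => e) ν = 1) {ε : Ω → Fin n → ℝ} (hε : HasLaw ε ν μ)
    (R : Matrix (Fin d) (Fin n) ℝ) (z : Fin n → ℝ) (i j : Fin d) :
    cov[fun ω => (R *ᵥ (z + ε ω)) i, fun ω => (R *ᵥ (z + ε ω)) j; μ] = (R * Rᵀ) i j := by
  have hε2 : ∀ k, MemLp (fun ω => ε ω k) 2 μ := fun k => memLp_comp_hasLaw hε (hν_sq k)
  have hcov : ∀ k l, cov[fun ω => ε ω k, fun ω => ε ω l; μ] = if k = l then 1 else 0 := by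
    intro k l
    rw [← Matrix.one_apply, ← hν_cov]
    exact hε.covariance_fun_comp (f := fun e => e k) (g := fun e => e l) (hν_sq k).1.aemeasurable
      (hν_sq l).1.aemeasurable
  simp only [Matrix.mulVec_add, Pi.add_apply]
  rw [covariance_const_add_left ((memLp_mulVec hε2 R i).integrable one_le_two),
    covariance_const_add_right ((memLp_mulVec hε2 R j).integrable one_le_two)]
  simp only [Matrix.mulVec, dotProduct]
  rw [covariance_fun_sum_fun_sum (fun k => (hε2 k).const_mul _) (fun k => (hε2 k).const_mul _)]
  simp only [covariance_const_mul_left, covariance_const_mul_right, hcov]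
  simp [Matrix.mul_apply, mul_comm]

lemma abs_covariance_chain_sub_le {p : unitInterval} {G H : Matrix (Fin d) (Fin d) ℝ} {α : ℝ}
    {e δ : ℕ → Ω → Fin d → ℝ} {V : Ω → Fin d → ℝ} (hH : ∀ i, H i i = 0)
    (hδ : ∀ k, HasLaw (δ k) (dropoutLaw d p) μ)
    (he : ∀ k, e (k + 1) =ᵐ[μ] fun ω => errStep G H α p (δ k ω) (e k ω) (V ω))
    (he0 : ∀ i, MemLp (fun ω => e 0 ω i) 2 μ) (hV : ∀ i, MemLp (fun ω => V ω i) 2 μ)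
    (hind : ∀ k, IndepFun (δ k) (fun ω => (e k ω, V ω)) μ)
    {T : ℝ} (hT : ∫ ω, e 0 ω ⬝ᵥ e 0 ω ∂μ ≤ T) (hT0 : 0 ≤ T) (hVT : ∫ ω, V ω ⬝ᵥ V ω ∂μ ≤ T) (k : ℕ)
    (i j : Fin d) :
    |cov[fun ω => e k ω i + V ω i, fun ω => e k ω j + V ω j; μ]
        - cov[fun ω => V ω i, fun ω => V ω j; μ]|
      ≤ ∫ ω, e k ω ⬝ᵥ e k ω ∂μ
        + 2 * (‖1 - (α * p) • offDiagScale p G‖ ^ k * (d * T)) := by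
  have hmem := memLp_chain hδ he he0 hV k
  have hcross : ∀ i j, |cov[fun ω => e k ω i, fun ω => V ω j; μ]|
      ≤ ‖1 - (α * p) • offDiagScale p G‖ ^ k * (d * T) := by
    intro i j
    rw [covariance_eq_integral_mul_sub_mean (hmem i) (hV j)]
    exact abs_integral_chain_mul_le hH hδ he he0 hV hind
      (φ := fun v => v j - ∫ x, V x j ∂μ) (by fun_prop) (memLp_sub_mean (hV j)) hT hT0
      ((integral_sub_mean_sq_le (hV j)).trans
        ((integral_sq_le_integral_dotProduct hV j).trans hVT)) k i
  -- The covariance of the minimizer cancels. What remains is the error covariance, bounded by its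
  -- second moment, and two geometrically decaying cross covariances.
  rw [covariance_add_add (hmem i) (hV i) (hmem j) (hV j), add_sub_cancel_right]
  have h1 := abs_covariance_le (hmem i) (hmem j)
  have h2 := hcross i j
  have h3 := hcross j i
  rw [covariance_comm] at h3
  have h4 := integral_sq_le_integral_dotProduct hmem i
  have h5 := integral_sq_le_integral_dotProduct hmem j
  refine (abs_add_three _ _ _).trans ?_
  linarith

lemma norm_le_of_abs_apply_le {A : Matrix (Fin d) (Fin d) ℝ} {c : ℝ} (h : ∀ i j, |A i j| ≤ c) :
    ‖A‖ ≤ d ^ 2 * c := by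
  refine (norm_le_sum_abs A).trans ?_
  calc ∑ i, ∑ j, |A i j| ≤ ∑ _i : Fin d, ∑ _j : Fin d, c :=
        Finset.sum_le_sum fun i _ => Finset.sum_le_sum fun j _ => h i j
    _ = d ^ 2 * c := by simp; ring

end Covariance

/-! ### The minimizer as a linear estimator -/

section Estimator

variable {n d : ℕ} (X : Matrix (Fin n) (Fin d) ℝ) {p : unitInterval}

lemma minimizer_eq {m : ℝ} (hm0 : 0 < m) (hm : ∀ i, m ≤ gram X i i) (hp0 : 0 < p) (hp1 : p < 1)
    {b : (Fin n → ℝ) → (Fin d → ℝ)} (hb : IsMarginalizedLossMinimizer X p b) (y : Fin n → ℝ) :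
    b y = ((offDiagScale p (gram X))⁻¹ * Xᵀ) *ᵥ y := by
  have hpos : (offDiagScale p (gram X)).PosDef := by
    refine Matrix.PosDef.of_dotProduct_mulVec_pos (isHermitian_offDiagScale_gram X) fun x hx => ?_
    have h := le_dotProduct_offDiagScale_gram X hm x (p := p)
    have hp' : 0 < 1 - (p : ℝ) := sub_pos.2 hp1
    have hx' : 0 < x ⬝ᵥ x :=
      lt_of_le_of_ne (dotProduct_self_nonneg_real x) fun h => hx (dotProduct_self_eq_zero.1 h.symm)
    rw [star_trivial]
    exact lt_of_lt_of_le (by positivity) h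
  rw [← Matrix.mulVec_mulVec, ← offDiagScale_gram_mulVec_minimizer X hp0 hb y, Matrix.mulVec_mulVec,
    Matrix.nonsing_inv_mul _ hpos.det_pos.ne'.isUnit, Matrix.one_mulVec]

/-- Follows from `G_p = Diag(G) + p H`; it exhibits the small-`p` limit of the minimizer as a
perturbation of order `p`. -/
lemma diagPart_inv_mulVec_eq {m : ℝ} (hm0 : 0 < m) (hm : ∀ i, m ≤ gram X i i)
    {v w : Fin d → ℝ} (hv : offDiagScale p (gram X) *ᵥ v = w) :
    (diagPart (gram X))⁻¹ *ᵥ w = v + (p : ℝ) • (((diagPart (gram X))⁻¹ * gramOff X) *ᵥ v) := by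
  have hdet : IsUnit (diagPart (gram X)).det := by
    rw [diagPart, Matrix.det_diagonal, isUnit_iff_ne_zero]
    exact Finset.prod_ne_zero_iff.2 fun i _ => (hm0.trans_le (hm i)).ne'
  have h : offDiagScale p (gram X) = diagPart (gram X) + (p : ℝ) • gramOff X := by
    simp only [offDiagScale, gramOff, smul_sub, sub_smul, one_smul]
    abel
  rw [← hv, h, Matrix.mulVec_mulVec, Matrix.mul_add, Matrix.nonsing_inv_mul _ hdet, Matrix.mul_smul,
    Matrix.add_mulVec, Matrix.one_mulVec, Matrix.smul_mulVec]

lemma transpose_diagPart_inv : ((diagPart (gram X))⁻¹)ᵀ = (diagPart (gram X))⁻¹ := by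
  rw [Matrix.transpose_nonsing_inv, diagPart, Matrix.diagonal_transpose]

end Estimator

/-! ### Making the constants uniform in `α`, `p` and `k` -/

section Bounds

variable {n d : ℕ} (X : Matrix (Fin n) (Fin d) ℝ) {p : unitInterval}

lemma norm_one_sub_smul_offDiagScale_le {t A : ℝ} (ht0 : 0 ≤ t) (htA : t ≤ A)
    (G : Matrix (Fin d) (Fin d) ℝ) :
    ‖1 - t • offDiagScale p G‖ ≤ ‖(1 : Matrix (Fin d) (Fin d) ℝ)‖ + A * (‖G‖ + ‖diagPart G‖) := by
  have hp0 : (0 : ℝ) ≤ p := p.2.1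
  have hp1 : (0 : ℝ) ≤ 1 - p := sub_nonneg.2 p.2.2
  refine (norm_sub_le _ _).trans ?_
  rw [norm_smul, Real.norm_of_nonneg ht0]
  have h : ‖offDiagScale p G‖ ≤ ‖G‖ + ‖diagPart G‖ := by
    rw [offDiagScale]
    refine (norm_add_le _ _).trans ?_
    rw [norm_smul, norm_smul, Real.norm_of_nonneg hp0, Real.norm_of_nonneg hp1]
    gcongr
    · exact mul_le_of_le_one_left (norm_nonneg _) p.2.2
    · exact mul_le_of_le_one_left (norm_nonneg _) (by linarith)
  gcongr
  exact ht0.trans htA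

lemma mul_norm_sq_le_of_lt_div {α l g : ℝ} (hα : 0 < α) (hlg : l ≤ g) (hg0 : 0 ≤ g)
    (h : α < l / (3 * g ^ 2)) : 0 < g ∧ α * g ^ 2 ≤ l ∧ α ≤ 1 / g := by
  have hg : 0 < g := by
    rcases hg0.eq_or_lt with h0 | h0
    -- If `g = 0`, the quotient is `0` by convention and contradicts `0 < α`.
    · rw [← h0] at h; norm_num at h; linarith
    · exact h0
  have h2 : α * (3 * g ^ 2) < l := (lt_div_iff₀ (by positivity)).1 h
  have h3 : 0 < α * g ^ 2 := by positivity
  refine ⟨hg, by linarith, ?_⟩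
  rw [le_div_iff₀ hg]
  have : α * g * g ≤ 1 * g := by nlinarith
  exact le_of_mul_le_mul_right this hg

/-- For `k ≥ 1` the term `q^k` is at most `k q^(k-1) Q`, so all transient terms merge into one. -/
lemma geometric_bound_le {q Q A α t c w m s D : ℝ} {k : ℕ} (hk : 1 ≤ k) (hq : 0 ≤ q) (hqQ : q ≤ Q)
    (hα : 0 ≤ α) (hαA : α ≤ A) (hc : 0 ≤ c) (hs : 0 ≤ s) (hD : 0 ≤ D) :
    q ^ k * D * s + k * q ^ (k - 1) * (2 * α ^ 2 * (c * s)) + α * t * (w * s / m)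
      ≤ (k * q ^ (k - 1) * (Q * D + 2 * A ^ 2 * c) + α * t * (w / m)) * s := by
  have hqk : q ^ k ≤ k * q ^ (k - 1) * Q := by
    have h1 : q ^ k = q ^ (k - 1) * q := by rw [← pow_succ, Nat.sub_add_cancel hk]
    have h2 : (1 : ℝ) ≤ k := by exact_mod_cast hk
    have hQ := hq.trans hqQ
    rw [h1]
    calc q ^ (k - 1) * q ≤ 1 * q ^ (k - 1) * Q := by rw [one_mul]; gcongr
      _ ≤ _ := by gcongr
  have h2 : k * q ^ (k - 1) * (2 * α ^ 2 * (c * s))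
      ≤ k * q ^ (k - 1) * (2 * A ^ 2 * (c * s)) := by gcongr
  have h3 : q ^ k * D * s ≤ k * q ^ (k - 1) * Q * D * s := by gcongr
  have h4 : α * t * (w * s / m) = α * t * (w / m) * s := by ring
  rw [h4]
  linarith

/-- One pair of constants must serve both estimates: `c₂` is needed for `x`, `2 * (1 + z)` for `y`.
As `y` carries `t` without `α`, the sum has the factor `t * (1 + α)`. -/
lemma le_of_scaled_bounds {x y D K c₁ c₂ z T P α t : ℝ} (hD : 0 ≤ D) (hc₂ : 0 ≤ c₂) (hz : 0 ≤ z)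
    (hT : 0 ≤ T) (hP : 0 < P) (hα : 0 ≤ α) (ht : 0 ≤ t)
    (hx : x ≤ D * ((K * c₁ + α * t * c₂) * (T / P)))
    (hy : y ≤ D * (2 * t * (T / P + z * (T / P)))) :
    x ≤ (K * (D * (c₁ * T)) + α * t * (D * ((c₂ + 2 * (1 + z)) * T))) / P ∧
      x + y ≤ (K * (D * (c₁ * T)) + t * (1 + α) * (D * ((c₂ + 2 * (1 + z)) * T))) / P := by
  have e1 : 0 ≤ α * t * (D * (2 * (1 + z) * T)) := by positivity
  have e2 : 0 ≤ t * (D * (c₂ * T)) := by positivity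
  rw [show D * ((K * c₁ + α * t * c₂) * (T / P)) = D * ((K * c₁ + α * t * c₂) * T) / P by ring,
    le_div_iff₀ hP] at hx
  rw [show D * (2 * t * (T / P + z * (T / P))) = D * (2 * t * (T + z * T)) / P by ring,
    le_div_iff₀ hP] at hy
  rw [le_div_iff₀ hP, le_div_iff₀ hP]
  constructor <;> linarith

end Bounds

/-! ### Covariance estimates for the regression model -/

section Model

variable {n d : ℕ} (X : Matrix (Fin n) (Fin d) ℝ) {p : unitInterval} {m : ℝ}
  {Ω : Type*} [MeasurableSpace Ω] {μ : Measure Ω}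
  {Y : Ω → Fin n → ℝ} {b : (Fin n → ℝ) → (Fin d → ℝ)}

lemma memLp_minimizer (hm0 : 0 < m) (hm : ∀ i, m ≤ gram X i i) (hp0 : 0 < p) (hp1 : p < 1)
    (hYsq : ∀ i, MemLp (fun ω => Y ω i) 2 μ) (hb : IsMarginalizedLossMinimizer X p b) (i : Fin d) :
    MemLp (fun ω => b (Y ω) i) 2 μ := by
  simp only [minimizer_eq X hm0 hm hp0 hp1 hb]
  exact memLp_mulVec hYsq _ i

lemma measurable_minimizer (hm0 : 0 < m) (hm : ∀ i, m ≤ gram X i i) (hp0 : 0 < p) (hp1 : p < 1)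
    (hb : IsMarginalizedLossMinimizer X p b) : Measurable b := by
  rw [funext (minimizer_eq X hm0 hm hp0 hp1 hb)]
  exact Continuous.measurable (by fun_prop)

lemma integral_minimizer_sq_le (hm0 : 0 < m) (hm : ∀ i, m ≤ gram X i i) (hp0 : 0 < p) (hp1 : p < 1)
    (hYsq : ∀ i, MemLp (fun ω => Y ω i) 2 μ) (hb : IsMarginalizedLossMinimizer X p b) :
    ∫ ω, b (Y ω) ⬝ᵥ b (Y ω) ∂μ
      ≤ (∫ ω, (Xᵀ *ᵥ Y ω) ⬝ᵥ (Xᵀ *ᵥ Y ω) ∂μ) / m ^ 2 / (1 - (p : ℝ)) ^ 2 := by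
  have hXY := memLp_mulVec hYsq Xᵀ
  have hVsq := memLp_minimizer X hm0 hm hp0 hp1 hYsq hb
  rw [← integral_div, ← integral_div]
  exact integral_mono (integrable_dotProduct hVsq hVsq)
    (((integrable_dotProduct hXY hXY).div_const _).div_const _)
    fun ω => dotProduct_self_le_of_offDiagScale_mulVec X hm0 hm hp1
      (offDiagScale_gram_mulVec_minimizer X hp0 hb (Y ω))

variable [IsProbabilityMeasure μ]

lemma abs_covMatrix_minimizer_sub_le (hm0 : 0 < m) (hm : ∀ i, m ≤ gram X i i) (hp0 : 0 < p)
    (hp1 : p < 1) {ν : Measure (Fin n → ℝ)}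
    (hν_sq : ∀ i, MemLp (fun e : Fin n → ℝ => e i) 2 ν)
    (hν_cov : covMatrix (fun e : Fin n → ℝ => e) ν = 1) {ε : Ω → Fin n → ℝ} (hε : HasLaw ε ν μ)
    {z : Fin n → ℝ} (hY : ∀ ω, Y ω = z + ε ω) (hYsq : ∀ i, MemLp (fun ω => Y ω i) 2 μ)
    (hb : IsMarginalizedLossMinimizer X p b) {s : ℝ} (hVs : ∫ ω, b (Y ω) ⬝ᵥ b (Y ω) ∂μ ≤ s)
    (i j : Fin d) :
    |(covMatrix (fun ω => b (Y ω)) μ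
        - (diagPart (gram X))⁻¹ * gram X * (diagPart (gram X))⁻¹) i j|
      ≤ 2 * p * (s + ‖(diagPart (gram X))⁻¹ * gramOff X‖ ^ 2 * s) := by
  have hVsq := memLp_minimizer X hm0 hm hp0 hp1 hYsq hb
  have h := abs_covariance_perturb_le hVsq
    (memLp_mulVec hVsq ((diagPart (gram X))⁻¹ * gramOff X)) p.2.1 p.2.2 hVs
    ((integral_mulVec_sq_le hVsq _).trans (mul_le_mul_of_nonneg_left hVs (sq_nonneg _))) i j
  have h1 : ∀ ω i, b (Y ω) i + p * (((diagPart (gram X))⁻¹ * gramOff X) *ᵥ b (Y ω)) i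
      = (((diagPart (gram X))⁻¹ * Xᵀ) *ᵥ (z + ε ω)) i := by
    intro ω i
    rw [← hY, ← Matrix.mulVec_mulVec (Y ω), diagPart_inv_mulVec_eq X hm0 hm
      (offDiagScale_gram_mulVec_minimizer X hp0 hb (Y ω))]
    rfl
  simp only [h1] at h
  rw [covariance_linear_noise hν_sq hν_cov hε] at h
  have h2 : (diagPart (gram X))⁻¹ * Xᵀ * ((diagPart (gram X))⁻¹ * Xᵀ)ᵀ
      = (diagPart (gram X))⁻¹ * gram X * (diagPart (gram X))⁻¹ := by
    rw [Matrix.transpose_mul, Matrix.transpose_transpose, transpose_diagPart_inv]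
    conv_rhs => rw [gram]
    simp only [Matrix.mul_assoc]
    rfl
  rw [h2] at h
  exact h

lemma abs_covMatrix_dropoutIterate_sub_le (hd : 0 < d) (hm0 : 0 < m) (hm : ∀ i, m ≤ gram X i i)
    (hp0 : 0 < p) (hp1 : p < 1) {α : ℝ} (hα : 0 < α) (hαp : α * p * ‖gram X‖ < 1)
    (hαG : α * ‖gram X‖ ^ 2 ≤ lambdaMin (offDiagScale p (gram X)))
    {β₀ : Ω → Fin d → ℝ} {δ : ℕ → Ω → Fin d → ℝ}
    (hβsq : ∀ i, MemLp (fun ω => β₀ ω i) 2 μ) (hYsq : ∀ i, MemLp (fun ω => Y ω i) 2 μ)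
    (hδ : ∀ k, HasLaw (δ k) (dropoutLaw d p) μ) (hδi : iIndepFun δ μ)
    (hδY : IndepFun (fun ω k => δ k ω) (fun ω => (Y ω, β₀ ω)) μ)
    (hb : IsMarginalizedLossMinimizer X p b) {s : ℝ} (hs0 : 0 ≤ s)
    (hVs : ∫ ω, b (Y ω) ⬝ᵥ b (Y ω) ∂μ ≤ s)
    (he0s : ∫ ω, (β₀ ω - b (Y ω)) ⬝ᵥ (β₀ ω - b (Y ω)) ∂μ ≤ s) (k : ℕ) (i j : Fin d) :
    |(covMatrix (fun ω => dropoutIterate X α (Y ω) (β₀ ω) (fun j => δ j ω) k) μ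
        - covMatrix (fun ω => b (Y ω)) μ) i j|
      ≤ ‖1 - (α * p) • offDiagScale p (gram X)‖ ^ k * (1 + 2 * d) * s
        + k * ‖1 - (α * p) • offDiagScale p (gram X)‖ ^ (k - 1)
          * (2 * α ^ 2 * (d ^ 4 * (‖gram X‖ * ‖gramOff X‖) * s))
        + α * p * (d ^ 2 * ‖gramOff X‖ ^ 2 * s / m) := by
  have hherm := isHermitian_offDiagScale_gram X (p := p)
  have hml := le_lambdaMin hd hherm (le_dotProduct_offDiagScale_gram X hm)
  have hr0 : 0 ≤ 1 - α * p * lambdaMin (offDiagScale p (gram X)) := by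
    have := mul_le_mul_of_nonneg_left (lambdaMin_offDiagScale_gram_le X hd (p := p))
      (mul_nonneg hα.le p.2.1)
    linarith
  have hrq := one_sub_mul_lambdaMin_le_norm hd hherm (α * p)
  have hVsq := memLp_minimizer X hm0 hm hp0 hp1 hYsq hb
  have hbm := measurable_minimizer X hm0 hm hp0 hp1 hb
  -- Introduced through an equation, the error stays opaque except where `he` is rewritten.
  obtain ⟨e, he⟩ : ∃ e : ℕ → Ω → Fin d → ℝ, e = fun k ω =>
    dropoutIterate X α (Y ω) (β₀ ω) (fun j => δ j ω) k - b (Y ω) := ⟨_, rfl⟩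
  have he0 : e 0 = fun ω => β₀ ω - b (Y ω) := by rw [he]; rfl
  have he0sq : ∀ i, MemLp (fun ω => e 0 ω i) 2 μ := fun i => by
    rw [he0]; exact (hβsq i).sub (hVsq i)
  have hstep : ∀ k, e (k + 1) =ᵐ[μ] fun ω =>
      errStep (gram X) (gramOff X) α p (δ k ω) (e k ω) (b (Y ω)) := by
    intro k
    have h := ae_dropoutLaw (d := d) (p := p)
    rw [← (hδ k).map_eq] at h
    filter_upwards [ae_of_ae_map (hδ k).aemeasurable h] with ω hω
    rw [he]
    exact step_sub_eq_errStep X hω α (offDiagScale_gram_mulVec_minimizer X hp0 hb (Y ω)) _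
  have hind : ∀ k, IndepFun (δ k) (fun ω => (e k ω, b (Y ω))) μ := by
    intro k
    rw [he]
    exact indepFun_dropoutIterate X (fun k => (hδ k).aemeasurable)
      (aemeasurable_of_memLp hYsq) (aemeasurable_of_memLp hβsq) hδi hδY
      (f := fun q => (q.1 - b q.2, b q.2)) (by fun_prop) α k
  have hHd := gramOff_apply_self X
  have he0s' : ∫ ω, e 0 ω ⬝ᵥ e 0 ω ∂μ ≤ s := by rw [he0]; exact he0s
  have hak := integral_chain_sq_le hHd hδ hstep he0sq hVsq hind he0s' hs0 hVs hα hm0 hml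
    (lambdaMin_mul_le hherm) hαG hr0 hrq k
  have h := abs_covariance_chain_sub_le hHd hδ hstep he0sq hVsq hind he0s' hs0 hVs k i j
  have h1 : ∀ ω i, e k ω i + b (Y ω) i
      = dropoutIterate X α (Y ω) (β₀ ω) (fun j => δ j ω) k i := fun ω i => by simp [he]
  simp only [h1] at h
  refine (h.trans (add_le_add hak le_rfl)).trans (le_of_eq ?_)
  ring

end Model

end Dropout

/-- `ν` is the law of the regression noise and `π` the law of the initialization; the constants
depend only on the design, the regression vector and these two laws. -/
theorem mainTheorem7 {n d : ℕ} (X : Matrix (Fin n) (Fin d) ℝ)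
    (hX : ∀ j, ∃ i, X i j ≠ 0)
    (βstar : Fin d → ℝ)
    (ν : Measure (Fin n → ℝ)) [IsProbabilityMeasure ν]
    (hν_sq : ∀ i, MemLp (fun e : Fin n → ℝ => e i) 2 ν)
    (hν_mean : ∀ i, ∫ e, e i ∂ν = 0)
    (hν_cov : Dropout.covMatrix (fun e : Fin n → ℝ => e) ν = 1)
    (π : Measure (Fin d → ℝ)) [IsProbabilityMeasure π]
    (hπ_sq : ∀ i, MemLp (fun b : Fin d → ℝ => b i) 2 π) :
    ∃ C' C'' : ℝ, ∀ (α : ℝ) (p : unitInterval), 0 < α → 0 < p → p < 1 →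
      α * p * ‖Dropout.gram X‖ < 1 →
      α < Dropout.lambdaMin (Dropout.offDiagScale p (Dropout.gram X))
        / (3 * ‖Dropout.gram X‖ ^ 2) →
      ∀ (Ω : Type*) [MeasurableSpace Ω] (μ : Measure Ω) [IsProbabilityMeasure μ]
        (ε Y : Ω → Fin n → ℝ) (β₀ : Ω → Fin d → ℝ) (δ : ℕ → Ω → Fin d → ℝ)
        (b : (Fin n → ℝ) → (Fin d → ℝ)),
        HasLaw ε ν μ →
        (∀ ω, Y ω = X *ᵥ βstar + ε ω) →
        HasLaw β₀ π μ →
        IndepFun β₀ Y μ →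
        (∀ k, HasLaw (δ k) (Dropout.dropoutLaw d p) μ) →
        iIndepFun δ μ →
        IndepFun (fun ω k => δ k ω) (fun ω => (Y ω, β₀ ω)) μ →
        Dropout.IsMarginalizedLossMinimizer X p b →
        ∀ k : ℕ, 1 ≤ k →
          ‖Dropout.covMatrix
                (fun ω => Dropout.dropoutIterate X α (Y ω) (β₀ ω) (fun j => δ j ω) k) μ
              - Dropout.covMatrix (fun ω => b (Y ω)) μ‖
            ≤ (k * ‖1 - (α * p) • Dropout.offDiagScale p (Dropout.gram X)‖ ^ (k - 1) * C'
                + α * p * C'') / (1 - p) ^ 2 ∧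
          ‖Dropout.covMatrix
                (fun ω => Dropout.dropoutIterate X α (Y ω) (β₀ ω) (fun j => δ j ω) k) μ
              - (Dropout.diagPart (Dropout.gram X))⁻¹ * Dropout.gram X
                * (Dropout.diagPart (Dropout.gram X))⁻¹‖
            ≤ (k * ‖1 - (α * p) • Dropout.offDiagScale p (Dropout.gram X)‖ ^ (k - 1) * C'
                + p * (1 + α) * C'') / (1 - p) ^ 2 := by
  obtain ⟨m, hm0, hm⟩ := Dropout.exists_le_gram_diag X hX
  set G := Dropout.gram X with hG
  set H := Dropout.gramOff X with hH
  set Z := (Dropout.diagPart G)⁻¹ * H with hZ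
  set S₀ := ∫ b, b ⬝ᵥ b ∂π with hS₀
  set S₁ := ∫ e, (Xᵀ *ᵥ (X *ᵥ βstar + e)) ⬝ᵥ (Xᵀ *ᵥ (X *ᵥ βstar + e)) ∂ν with hS₁
  have hS₀0 : 0 ≤ S₀ := integral_nonneg fun b => Dropout.dotProduct_self_nonneg_real b
  have hS₁0 : 0 ≤ S₁ := integral_nonneg fun b => Dropout.dotProduct_self_nonneg_real _
  -- From `‖β₀ - v‖² ≤ 2 ‖β₀‖² + 2 ‖v‖²`: both `E‖v‖²` and the initial mean squared error are at
  -- most `T / (1 - p)²`.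
  set T := 2 * S₀ + 2 * (S₁ / m ^ 2) with hT
  have hT0 : 0 ≤ T := by positivity
  set Q := ‖(1 : Matrix (Fin d) (Fin d) ℝ)‖ + 1 / ‖G‖ * (‖G‖ + ‖Dropout.diagPart G‖) with hQ
  have hQ0 : 0 ≤ Q := by positivity
  set c := d ^ 4 * (‖G‖ * ‖H‖) with hc
  set c₂ := d ^ 2 * ‖H‖ ^ 2 / m with hc₂
  have hc0 : 0 ≤ c := by positivity
  have hc₂0 : 0 ≤ c₂ := by positivity
  -- `1 / ‖G‖` is a uniform bound on `α`, and `Q` the resulting bound on `q`. The factor `d ^ 2` is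
  -- the cost of passing from entries to the spectral norm.
  refine ⟨d ^ 2 * ((Q * (1 + 2 * d) + 2 * (1 / ‖G‖) ^ 2 * c) * T),
    d ^ 2 * ((c₂ + 2 * (1 + ‖Z‖ ^ 2)) * T), ?_⟩
  intro α p hα hp0 hp1 hαp hαl Ω _ μ _ ε Y β₀ δ b hε hY hβ₀ _ hδ hδi hδY hb k hk
  have hp0' : (0 : ℝ) < p := hp0
  have hp1' : (0 : ℝ) < 1 - p := sub_pos.2 hp1
  have hd : 0 < d := by
    -- For `d = 0` the step-size bound is a division by zero, hence `0`, contradicting `0 < α`.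
    rcases Nat.eq_zero_or_pos d with h | h
    · subst h
      have : ‖G‖ = 0 := by rw [Subsingleton.elim G 0, norm_zero]
      rw [this] at hαl
      norm_num at hαl
      linarith
    · exact h
  set l := Dropout.lambdaMin (Dropout.offDiagScale p G) with hl
  have hlG : l ≤ ‖G‖ := Dropout.lambdaMin_offDiagScale_gram_le X hd
  obtain ⟨hG0, hαG, hαA⟩ := Dropout.mul_norm_sq_le_of_lt_div hα hlG (norm_nonneg _) hαl
  set q := ‖1 - (α * p) • Dropout.offDiagScale p G‖ with hq
  have hqQ : q ≤ Q := by
    refine Dropout.norm_one_sub_smul_offDiagScale_le (by positivity) (le_trans ?_ hαA) G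
    exact mul_le_of_le_one_right hα.le p.2.2
  have hεsq : ∀ i, MemLp (fun ω => ε ω i) 2 μ := fun i =>
    Dropout.memLp_comp_hasLaw hε (hν_sq i)
  have hβsq : ∀ i, MemLp (fun ω => β₀ ω i) 2 μ := fun i =>
    Dropout.memLp_comp_hasLaw hβ₀ (hπ_sq i)
  have hYsq : ∀ i, MemLp (fun ω => Y ω i) 2 μ := fun i => by
    simp only [hY, Pi.add_apply]
    exact (memLp_const ((X *ᵥ βstar) i)).add (hεsq i)
  have hVsq := Dropout.memLp_minimizer X hm0 hm hp0 hp1 hYsq hb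
  set s := T / (1 - (p : ℝ)) ^ 2 with hs
  have hs0 : 0 ≤ s := by positivity
  have hVint : ∫ ω, b (Y ω) ⬝ᵥ b (Y ω) ∂μ ≤ S₁ / m ^ 2 / (1 - (p : ℝ)) ^ 2 := by
    have h1 : ∫ ω, (Xᵀ *ᵥ Y ω) ⬝ᵥ (Xᵀ *ᵥ Y ω) ∂μ = S₁ := by
      simp only [hY]
      exact hε.integral_comp
        (f := fun e => (Xᵀ *ᵥ (X *ᵥ βstar + e)) ⬝ᵥ (Xᵀ *ᵥ (X *ᵥ βstar + e)))
        (Continuous.aestronglyMeasurable (by fun_prop))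
    rw [← h1]
    exact Dropout.integral_minimizer_sq_le X hm0 hm hp0 hp1 hYsq hb
  have hVs : ∫ ω, b (Y ω) ⬝ᵥ b (Y ω) ∂μ ≤ s := by
    refine hVint.trans ?_
    rw [hs]
    gcongr
    have : 0 ≤ S₁ / m ^ 2 := by positivity
    linarith
  have he0s : ∫ ω, (β₀ ω - b (Y ω)) ⬝ᵥ (β₀ ω - b (Y ω)) ∂μ ≤ s := by
    have h1 : ∫ ω, β₀ ω ⬝ᵥ β₀ ω ∂μ = S₀ :=
      hβ₀.integral_comp (f := fun b => b ⬝ᵥ b) (Continuous.aestronglyMeasurable (by fun_prop))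
    have h2 : S₀ ≤ S₀ / (1 - (p : ℝ)) ^ 2 :=
      le_div_self hS₀0 (by positivity) (pow_le_one₀ hp1'.le (by linarith))
    calc ∫ ω, (β₀ ω - b (Y ω)) ⬝ᵥ (β₀ ω - b (Y ω)) ∂μ
        ≤ 2 * ∫ ω, β₀ ω ⬝ᵥ β₀ ω ∂μ + 2 * ∫ ω, b (Y ω) ⬝ᵥ b (Y ω) ∂μ :=
          Dropout.integral_sub_sq_le hβsq hVsq
      _ ≤ 2 * (S₀ / (1 - (p : ℝ)) ^ 2) + 2 * (S₁ / m ^ 2 / (1 - (p : ℝ)) ^ 2) := by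
          rw [h1]; gcongr
      _ = s := by rw [hs, hT]; ring
  have hfirst : ∀ i j,
      |(Dropout.covMatrix
          (fun ω => Dropout.dropoutIterate X α (Y ω) (β₀ ω) (fun j => δ j ω) k) μ
          - Dropout.covMatrix (fun ω => b (Y ω)) μ) i j|
        ≤ (k * q ^ (k - 1) * (Q * (1 + 2 * d) + 2 * (1 / ‖G‖) ^ 2 * c) + α * p * c₂) * s := by
    intro i j
    exact (Dropout.abs_covMatrix_dropoutIterate_sub_le X hd hm0 hm hp0 hp1 hα hαp hαG hβsq hYsq
      hδ hδi hδY hb hs0 hVs he0s k i j).trans (Dropout.geometric_bound_le hk (norm_nonneg _) hqQ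
        hα.le hαA hc0 hs0 (by positivity))
  have hsecond := Dropout.abs_covMatrix_minimizer_sub_le X hm0 hm hp0 hp1 hν_sq hν_cov hε hY hYsq
    hb hVs
  have hn1 := Dropout.norm_le_of_abs_apply_le hfirst
  have hn2 := Dropout.norm_le_of_abs_apply_le hsecond
  have hfinal := Dropout.le_of_scaled_bounds (sq_nonneg (d : ℝ)) hc₂0 (sq_nonneg ‖Z‖) hT0
    (pow_pos hp1' 2) hα.le hp0'.le hn1 hn2
  refine ⟨hfinal.1, le_trans ?_ hfinal.2⟩
  rw [← sub_add_sub_cancel _ (Dropout.covMatrix (fun ω => b (Y ω)) μ)]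
  exact norm_add_le _ _
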